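/- **Setting.** A job $T=(r,p,d)$ has a release time $r\ge 0$, a processing time $p>0$, a deadline $d\ge r+p$, and value $v=p$ (proportional value model). An input instance $I$ is a finite list of jobs, ordered by release time. There is a single processor and preemption is free. Upon its release each job is accepted or declined, irrevocably. An accepted job that receives its full processing time $p$ within $[r,d]$ yields profit $p$; an accepted job that receives only $q<p$ units of processing within $[r,d]$ yields profit $-(p-q)$; a declined job yields $0$. Let $S(I)$ be the total profit of a scheduling algorithm $S$ on $I$, and $S^*_{\rm offline}(I)$ the optimal (supremal) profit over all schedules of $I$, all jobs being known in advance. A (deterministic) algorithm is online if for every $t$ its decisions on the jobs released by time $t$ and its use of the processor up to time $t$ depend only on the jobs released by time $t$. It is $\alpha$-competitive if $S(I)\ge\alpha\,S^*_{\rm offline}(I)$ for every instance $I$. **Algorithm DSC with threshold $1+\beta$.** It maintains a tentative schedule, which it executes, and a number $a_j$ for each accepted job $j$, the penalty attributed to the acceptance of $j$. A job is called *anticipated to complete* in a schedule if the schedule gives it its full processing time by its deadline. When a job $T=(r,p,d)$ is released, let $e$ be the end of the tentative schedule, or $r$ if the schedule ends before $r$. - If $e+p\le d$, accept $T$, append it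 in $[e,e+p]$, and attribute penalty $0$ to it. - Otherwise consider the following modified schedule: $T$ is placed in $[d-p,d]$, and the part of the tentative schedule after time $d-p$ is moved, in the same order, so as to start at time $d$; then every job that occurs in the moved part and is not anticipated to complete after the move is deleted from the moved part, and the remaining moved pieces are shifted forward to fill the gaps. Let $A$ be the set of jobs that receive less processing (by their deadlines) in the modified schedule than in the tentative one, let $\ell_j$ be the amount that $j\in A$ loses, and let $A'\subseteq A$ be the jobs of $A$ that are anticipated to complete in the tentative schedule. Put $$a=\sum_{j\in A}\ell_j+\sum_{j\in A'}a_j,\qquad \mathrm{Profit}_{\rm accept}=p-a,\qquad \mathrm{Profit}_{\rm decline}=\sum_{j\in A'}(p_j-a_j).$$ If $\mathrm{Profit}_{\rm accept}>(1+\beta)\,\mathrm{Profit}_{\rm decline}$, accept $T$, adopt the modified schedule, and attribute penalty $a$ to $T$; otherwise decline $T$ and keep the tentative schedule. **Theorem.** 1. DSC with $\beta=1+\sqrt2$ is an online algorithm and is $(3-2\sqrt2)$-competitive. 2. If some online algorithm is $\alpha$-competitive, then $\alpha\le 3-2\sqrt2$. -/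

import Mathlib

open MeasureTheory

noncomputable section

namespace DeadlineScheduling

/-! ## Jobs, input instances, schedules and profit -/

/-- A job, with its release time, processing time and deadline. -/
structure Job where
  release : ℝ
  proc : ℝ
  deadline : ℝ

/-- Proportional value model: the value of a job is its processing time. -/
def Job.value (J : Job) : ℝ := J.proc

/-- An input instance: finitely many jobs, listed in order of release (simultaneous releases are
presented in the order of the list), each with `deadline ≥ release + proc`. -/
structure JobInstance where
  jobs : List Job
  sorted : jobs.Pairwise (fun J K => J.release ≤ K.release)
  release_nonneg : ∀ J ∈ jobs, 0 ≤ J.release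
  proc_pos : ∀ J ∈ jobs, 0 < J.proc
  window : ∀ J ∈ jobs, J.release + J.proc ≤ J.deadline

/-- What a scheduler does on an instance: `admits i` says that the `i`-th job of the list is
accepted, and `run t` is the job that the single processor works on at time `t` (`none` when it is
idle). Preemption is free, so `run` is an arbitrary measurable assignment. -/
structure Schedule where
  admits : ℕ → Prop
  run : ℝ → Option ℕ
  measurable_run : ∀ i, MeasurableSet {t | run t = some i}

/-- The processing that job `J`, with index `i`, receives between its release and its deadline.
Time that `run` assigns to a job outside this window has no effect. -/
def Schedule.work (S : Schedule) (J : Job) (i : ℕ) : ℝ :=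
  (volume ({t | S.run t = some i} ∩ Set.Icc J.release J.deadline)).toReal

open Classical in
/-- Profit from the job `J`, with index `i`: zero if it is declined, its value if it is accepted and
completed by its deadline, and minus the unfinished workload if it is accepted but not completed. -/
def Schedule.jobProfit (S : Schedule) (J : Job) (i : ℕ) : ℝ :=
  if S.admits i then
    if J.proc ≤ S.work J i then J.value else -(J.proc - S.work J i)
  else 0

/-- Total profit of a schedule on an instance. -/
def profit (I : JobInstance) (S : Schedule) : ℝ :=
  ∑ i : Fin I.jobs.length, S.jobProfit I.jobs[i] i

/-- Profit of the optimal offline (clairvoyant) scheduler. -/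
def optOffline (I : JobInstance) : ℝ := ⨆ S : Schedule, profit I S

/-- The supremum defining `optOffline` is over a bounded set. -/
theorem bddAbove_profit (I : JobInstance) : BddAbove (Set.range (profit I)) := by
  refine ⟨∑ i : Fin I.jobs.length, I.jobs[i].proc, ?_⟩
  rintro _ ⟨S, rfl⟩
  refine Finset.sum_le_sum fun i _ => ?_
  have h := I.proc_pos I.jobs[i] (List.getElem_mem _)
  unfold Schedule.jobProfit Job.value
  split_ifs <;> linarith

/-- There is at least one schedule: decline every job. -/
instance : Nonempty Schedule :=
  ⟨{ admits := fun _ => False, run := fun _ => none, measurable_run := fun i => by simp }⟩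

/-! ## Online algorithms and competitive ratio -/

open Classical in
/-- The jobs of an instance that are released at or before time `t`. This is an initial segment of
the list of jobs. -/
def JobInstance.released (I : JobInstance) (t : ℝ) : List Job :=
  I.jobs.filter (fun J => J.release ≤ t)

/-- A (deterministic) scheduling algorithm is online if what it has done up to time `t`, namely its
decisions on the jobs released by time `t` and its use of the processor up to time `t`, depends only
on the jobs released by time `t`. In particular each job is accepted or declined upon its release,
once and for all. -/
def IsOnline (A : JobInstance → Schedule) : Prop :=
  ∀ (I I' : JobInstance) (t : ℝ), I.released t = I'.released t →
    (∀ i < (I.released t).length, (A I).admits i ↔ (A I').admits i) ∧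
    ∀ s ≤ t, (A I).run s = (A I').run s

/-- `A` is `α`-competitive: on every instance it obtains at least the fraction `α` of the optimal
offline profit. -/
def IsCompetitive (A : JobInstance → Schedule) (α : ℝ) : Prop :=
  ∀ I : JobInstance, α * optOffline I ≤ profit I (A I)

/-! ## The algorithm DSC -/

/-- Part of a tentative schedule: the job with index `job` occupies the processor in the time
interval `[left, right)`. -/
structure Piece where
  job : ℕ
  left : ℝ
  right : ℝ

/-- A tentative schedule, as a list of pieces in temporal order. The pieces executed in the past are
kept in the list. -/
abbrev Plan := List Piece

namespace Plan

/-- The end of the tentative schedule as seen at time `t`: the time from `t` on at which a new job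
can be appended. -/
def finish (P : Plan) (t : ℝ) : ℝ := (P.map Piece.right).foldl max t

/-- The processing that the job with index `j` receives in `P` up to time `d`. -/
def processedBy (P : Plan) (j : ℕ) (d : ℝ) : ℝ :=
  ((P.filter (fun g => g.job = j)).map (fun g => max (min g.right d - g.left) 0)).sum

open Classical in
/-- The part of the schedule before time `w`. -/
def before (P : Plan) (w : ℝ) : Plan :=
  (P.filter (fun g => g.left < w)).map (fun g => ⟨g.job, g.left, min g.right w⟩)

open Classical in
/-- The part of the schedule after time `w`. -/
def after (P : Plan) (w : ℝ) : Plan :=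
  (P.filter (fun g => w < g.right)).map (fun g => ⟨g.job, max g.left w, g.right⟩)

/-- The pieces of `P`, executed in the same order and without gaps from time `t` on. -/
def layOut : Plan → ℝ → Plan
  | [], _ => []
  | g :: P, t => ⟨g.job, t, t + (g.right - g.left)⟩ :: layOut P (t + (g.right - g.left))

open Classical in
/-- The use of the processor prescribed by `P`. -/
def run (P : Plan) (t : ℝ) : Option ℕ :=
  (P.find? (fun g => g.left ≤ t ∧ t < g.right)).map Piece.job

theorem measurable_run (P : Plan) (i : ℕ) : MeasurableSet {t | P.run t = some i} := by
  classical
  induction P with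
  | nil => simp [run]
  | cons g P ih =>
    have h : {t | run (g :: P) t = some i} =
        (Set.Ico g.left g.right ∩ {_t | g.job = i}) ∪
          ((Set.Ico g.left g.right)ᶜ ∩ {t | run P t = some i}) := by
      ext t
      by_cases ht : g.left ≤ t ∧ t < g.right
      · simp [run, List.find?_cons, ht]
      · have h' : ¬ t ∈ Set.Ico g.left g.right := ht
        simp only [Set.mem_ofPred_eq, Set.mem_union, Set.mem_inter_iff, h', Set.mem_compl_iff,
          not_false_eq_true, false_and, true_and, false_or]
        simp [run, ht]
    rw [h]
    exact (measurableSet_Ico.inter (MeasurableSet.const _)).union (measurableSet_Ico.compl.inter ih)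

end Plan

/-- The state of DSC: the jobs released so far, the tentative schedule, the accepted jobs, and for
each accepted job the portion of the non-completion penalty attributed to its acceptance (zero for a
job that was appended without affecting others). -/
structure DSCState where
  seen : List Job
  plan : Plan
  admitted : ℕ → Prop
  charge : ℕ → ℝ

namespace DSCState

/-- The state before the first release. -/
def init : DSCState := ⟨[], [], fun _ => False, fun _ => 0⟩

/-- The `j`-th job released is anticipated to be completed by its deadline in the schedule `P`. -/
def Completes (s : DSCState) (P : Plan) (j : ℕ) : Prop :=
  ∃ K, s.seen[j]? = some K ∧ K.proc ≤ P.processedBy j K.deadline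

/-- The tentative schedule is cut at time `deadline - proc`, the new job `J` is placed in
`[deadline - proc, deadline]`, and the part of the previous schedule after `deadline - proc` is moved
to start at the new end of the schedule, that is, at `deadline`. -/
def moved (s : DSCState) (J : Job) : Plan :=
  let w := J.deadline - J.proc
  s.plan.before w ++ [⟨s.seen.length, w, J.deadline⟩] ++ (s.plan.after w).layOut J.deadline

open Classical in
/-- The tentative schedule after accepting a new job `J` that cannot be appended: it is obtained from
`moved` by deleting, from the part that was moved, the jobs that are not completed by their deadlines
after the move, and by moving the others forward to fill the gaps. -/
def contend (s : DSCState) (J : Job) : Plan :=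
  let w := J.deadline - J.proc
  s.plan.before w ++ [⟨s.seen.length, w, J.deadline⟩] ++
    Plan.layOut ((s.plan.after w).filter (fun g => s.Completes (s.moved J) g.job)) J.deadline

open Classical in
/-- The jobs that receive less processing if the new job `J` is accepted by `contend`. -/
def affected (s : DSCState) (J : Job) : Finset (Fin s.seen.length) :=
  {j | (s.contend J).processedBy j s.seen[j].deadline < s.plan.processedBy j s.seen[j].deadline}

open Classical in
/-- The affected jobs that are anticipated to be completed in the current tentative schedule. -/
def ousted (s : DSCState) (J : Job) : Finset (Fin s.seen.length) :=
  {j ∈ s.affected J | s.Completes s.plan j}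

/-- The portion of the penalty attributed to the acceptance of `J`: the workload that the affected
jobs lose, and the penalties attributed so far to those affected jobs that were anticipated to be
completed. -/
def penaltyAccept (s : DSCState) (J : Job) : ℝ :=
  ∑ j ∈ s.affected J, (s.plan.processedBy j s.seen[j].deadline
      - (s.contend J).processedBy j s.seen[j].deadline)
    + ∑ j ∈ s.ousted J, s.charge j

/-- The profit associated with accepting `J`. -/
def profitAccept (s : DSCState) (J : Job) : ℝ := J.value - s.penaltyAccept J

/-- The profit associated with declining `J`: the value of the affected jobs that are anticipated to
be completed, less the portion of the penalty attributed to them. -/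
def profitDecline (s : DSCState) (J : Job) : ℝ :=
  ∑ j ∈ s.ousted J, (s.seen[j].value - s.charge j)

open Classical in
/-- The reaction of DSC to the release of a job `J`. -/
def step (β : ℝ) (s : DSCState) (J : Job) : DSCState :=
  let i := s.seen.length
  let e := s.plan.finish J.release
  if e + J.proc ≤ J.deadline then
    { seen := s.seen ++ [J]
      plan := s.plan ++ [⟨i, e, e + J.proc⟩]
      admitted := fun k => k = i ∨ s.admitted k
      charge := Function.update s.charge i 0 }
  else if s.profitAccept J > (1 + β) * s.profitDecline J then
    { seen := s.seen ++ [J]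
      plan := s.contend J
      admitted := fun k => k = i ∨ s.admitted k
      charge := Function.update s.charge i (s.penaltyAccept J) }
  else
    { s with seen := s.seen ++ [J] }

end DSCState

/-- The algorithm DSC with threshold `1 + β`. A release at time `r` changes the tentative schedule
only after time `r`, so that the last tentative schedule records what is actually executed. -/
def dsc (β : ℝ) (I : JobInstance) : Schedule :=
  let s := I.jobs.foldl (DSCState.step β) DSCState.init
  { admits := s.admitted
    run := s.plan.run
    measurable_run := s.plan.measurable_run }

end DeadlineScheduling

end

open DeadlineScheduling

/-!
**Why DSC is competitive.** The net value `b j` of an accepted job is its processing time less the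
penalty attributed to its acceptance. The attribution is made so that, at any time, the profit
anticipated from the tentative schedule is the sum of the net values of the jobs anticipated to be
completed. The optimal profit is compared with the same sum, as follows.

A job that was accepted by displacing others is planned right up to its deadline. Therefore, if it is
moved, it is ousted (`Sound.not_completes_moved_of_tight`), and so a new job that takes processing
from jobs ousted earlier also ousts the job to which their losses are attributed
(`Certificate.owner_of_mem_lost`). Every ousted job thus has an owner among the jobs anticipated to be
completed, and the penalty of the owner accounts for what is missing from the jobs that it owns. Since
a job is accepted only if its net value exceeds `2 + √2` times that of the jobs it ousts, the total
processing time of the jobs owned by `j` never exceeds `b j / √2`.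

Time is divided into busy periods, in which the tentative schedule has no gaps. The windows of all
jobs, except those that were appended and are completed, lie in the union of intervals, one for each
busy period, that start with it and extend beyond its end by at most what a declined job would have
needed after it, or by what an accepted job destroyed. So the optimal profit is at most the length of
these intervals plus the processing times of the appended jobs that are completed. The lengths are
paid for by the net values: a job `j` that displaced others pays `b j` for itself, at most
`2 * (b j / √2)` for the jobs it owns and the penalty it carries, and `(2 + √2) * b j` for a declined
job that would oust it, in total `3 + 2√2` times its net value; a job that was appended pays
`(4 + √2) * b j`, its processing time being counted twice. `Certificate` records this bookkeeping,
and `Certificate.nonempty_append`, `Certificate.nonempty_accept` and `Certificate.nonempty_decline`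
maintain it.

**Why no online algorithm does better.** The adversary releases, in quick succession, jobs without
slack whose sizes grow by a factor slightly above `1`. At most one of them can be completed, and those
accepted before it are lost almost entirely. To remain `α`-competitive the algorithm has to raise its
profit again and again by accepting a new job. If `u` is the ratio of the total size accepted to the
profit, then a rise takes `u` to at least `(u + c) / (c - u)`, with `c` close to `1 / α`. For
`c < 3 + 2√2` this exceeds `u` by a fixed amount (`ratio_rises`), whereas `u < c` is necessary for a
rise; so the rises come to an end, while the sizes keep growing (`exists_bestProfit_lt`).
-/

namespace DeadlineScheduling

/-! ### Tentative schedules -/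

namespace Plan

/-- The total length of the pieces of `P` that belong to job `j`, whatever their position. -/
noncomputable def load (P : Plan) (j : ℕ) : ℝ :=
  ((P.filter (fun g => g.job = j)).map (fun g => g.right - g.left)).sum

/-- The total length of all pieces of `P`. -/
noncomputable def total (P : Plan) : ℝ := (P.map (fun g => g.right - g.left)).sum

/-- The pieces of `P`, in order, are nonempty and partition the interval `[a, b)`. -/
def Tiles : Plan → ℝ → ℝ → Prop
  | [], a, b => a = b
  | g :: P, a, b => g.left = a ∧ g.left < g.right ∧ Tiles P g.right b

@[simp] theorem load_nil (j : ℕ) : load [] j = 0 := rfl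

theorem load_cons (g : Piece) (P : Plan) (j : ℕ) :
    load (g :: P) j = (if g.job = j then g.right - g.left else 0) + load P j := by
  by_cases h : g.job = j <;> simp [load, h]

theorem load_append (P Q : Plan) (j : ℕ) : load (P ++ Q) j = load P j + load Q j := by
  simp [load]

@[simp] theorem total_nil : total [] = 0 := rfl

@[simp] theorem total_cons (g : Piece) (P : Plan) :
    total (g :: P) = (g.right - g.left) + total P := by
  simp [total]

theorem processedBy_cons (g : Piece) (P : Plan) (j : ℕ) (d : ℝ) :
    processedBy (g :: P) j d =
      (if g.job = j then max (min g.right d - g.left) 0 else 0) + processedBy P j d := by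
  by_cases h : g.job = j <;> simp [processedBy, h]

theorem load_eq_zero {P : Plan} {j : ℕ} (h : ∀ g ∈ P, g.job ≠ j) : load P j = 0 := by
  have : P.filter (fun g => g.job = j) = [] := by simpa [List.filter_eq_nil_iff] using h
  simp [load, this]

theorem load_nonneg {P : Plan} (h : ∀ g ∈ P, g.left < g.right) (j : ℕ) : 0 ≤ load P j := by
  refine List.sum_nonneg fun x hx => ?_
  obtain ⟨g, hg, rfl⟩ := List.mem_map.1 hx
  have := h g (List.mem_of_mem_filter hg)
  linarith

theorem load_pos {P : Plan} (h : ∀ g ∈ P, g.left < g.right) {g : Piece} (hg : g ∈ P) :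
    0 < load P g.job := by
  induction P with
  | nil => simp at hg
  | cons k P ih =>
    have hk := h k (by simp)
    have hP : ∀ g ∈ P, g.left < g.right := fun g hg => h g (by simp [hg])
    have h0 := load_nonneg hP g.job
    rw [load_cons]
    rcases List.mem_cons.1 hg with rfl | hg
    · simp only [if_true]; linarith
    · have := ih hP hg
      split_ifs <;> linarith

theorem exists_mem_of_load_pos {P : Plan} {j : ℕ} (h : 0 < load P j) : ∃ g ∈ P, g.job = j := by
  by_contra! hc
  rw [load_eq_zero hc] at h
  exact h.false

theorem processedBy_eq_load {P : Plan} {j : ℕ} {d : ℝ}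
    (h : ∀ g ∈ P, g.job = j → g.left < g.right ∧ g.right ≤ d) : processedBy P j d = load P j := by
  unfold processedBy load
  congr 1
  refine List.map_congr_left fun g hg => ?_
  have hg' := List.mem_filter.1 hg
  obtain ⟨h1, h2⟩ := h g hg'.1 (by simpa using hg'.2)
  rw [min_eq_left h2, max_eq_left (by linarith)]

theorem processedBy_le_load {P : Plan} (h : ∀ g ∈ P, g.left < g.right) (j : ℕ) (d : ℝ) :
    processedBy P j d ≤ load P j := by
  refine List.sum_le_sum fun g hg => ?_
  have := h g (List.mem_of_mem_filter hg)
  exact max_le (by linarith [min_le_left g.right d]) (by linarith)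

/-- If the whole load of `j` is counted by time `d`, then every piece of `j` ends by `d`. -/
theorem right_le_of_load_le {P : Plan} (h : ∀ g ∈ P, g.left < g.right) {j : ℕ} {d : ℝ}
    (hl : load P j ≤ processedBy P j d) : ∀ g ∈ P, g.job = j → g.right ≤ d := by
  induction P with
  | nil => simp
  | cons k P ih =>
    have hk := h k (by simp)
    have hP : ∀ g ∈ P, g.left < g.right := fun g hg => h g (by simp [hg])
    have h1 := processedBy_le_load hP j d
    rw [load_cons, processedBy_cons] at hl
    intro g hg hj
    rcases List.mem_cons.1 hg with rfl | hg
    · simp only [hj, if_true] at hl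
      by_contra! hd
      have : max (min g.right d - g.left) 0 < g.right - g.left := by
        rw [min_eq_right hd.le]
        exact max_lt (by linarith) (by linarith)
      linarith
    · refine ih hP ?_ g hg hj
      split_ifs at hl
      · have : max (min k.right d - k.left) 0 ≤ k.right - k.left :=
          max_le (by linarith [min_le_left k.right d]) (by linarith)
        linarith
      · linarith

theorem total_eq_sum_load {P : Plan} {n : ℕ} (h : ∀ g ∈ P, g.job < n) :
    total P = ∑ j ∈ Finset.range n, load P j := by
  induction P with
  | nil => simp
  | cons g P ih =>
    rw [total_cons, ih fun g hg => h g (by simp [hg])]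
    simp only [load_cons, Finset.sum_add_distrib]
    rw [Finset.sum_ite_eq, if_pos (Finset.mem_range.2 (h g (by simp)))]

/-! #### Cutting a schedule -/

theorem mem_before {P : Plan} {w : ℝ} {g : Piece} (hg : g ∈ P.before w) :
    ∃ k ∈ P, g.job = k.job ∧ g.left = k.left ∧ k.left < w ∧ g.right = min k.right w := by
  simp only [before, List.mem_map, List.mem_filter, decide_eq_true_eq] at hg
  obtain ⟨k, ⟨hk, hw⟩, rfl⟩ := hg
  exact ⟨k, hk, rfl, rfl, hw, rfl⟩

theorem mem_after {P : Plan} {w : ℝ} {g : Piece} (hg : g ∈ P.after w) :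
    ∃ k ∈ P, g.job = k.job ∧ g.left = max k.left w ∧ w < k.right ∧ g.right = k.right := by
  simp only [after, List.mem_map, List.mem_filter, decide_eq_true_eq] at hg
  obtain ⟨k, ⟨hk, hw⟩, rfl⟩ := hg
  exact ⟨k, hk, rfl, rfl, hw, rfl⟩

theorem mk_mem_after {P : Plan} {w : ℝ} {g : Piece} (hg : g ∈ P) (hw : w < g.right) :
    (⟨g.job, max g.left w, g.right⟩ : Piece) ∈ P.after w := by
  simp only [after, List.mem_map, List.mem_filter, decide_eq_true_eq]
  exact ⟨g, ⟨hg, hw⟩, rfl⟩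

theorem mem_before_of_right_le {P : Plan} {w : ℝ} {g : Piece} (hg : g ∈ P)
    (hlr : g.left < g.right) (hw : g.right ≤ w) : g ∈ P.before w := by
  simp only [before, List.mem_map, List.mem_filter, decide_eq_true_eq]
  exact ⟨g, ⟨hg, by linarith⟩, by rw [min_eq_left hw]⟩

theorem before_proper {P : Plan} (h : ∀ g ∈ P, g.left < g.right) (w : ℝ) :
    ∀ g ∈ P.before w, g.left < g.right := by
  intro g hg
  obtain ⟨k, hk, -, h2, h3, h4⟩ := mem_before hg
  rw [h2, h4]
  exact lt_min (h k hk) h3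

theorem after_proper {P : Plan} (h : ∀ g ∈ P, g.left < g.right) (w : ℝ) :
    ∀ g ∈ P.after w, g.left < g.right := by
  intro g hg
  obtain ⟨k, hk, -, h2, h3, h4⟩ := mem_after hg
  rw [h2, h4]
  exact max_lt (h k hk) h3

theorem before_append (P Q : Plan) (w : ℝ) : before (P ++ Q) w = before P w ++ before Q w := by
  simp [before]

theorem after_append (P Q : Plan) (w : ℝ) : after (P ++ Q) w = after P w ++ after Q w := by
  simp [after]

theorem before_eq_self {P : Plan} {w : ℝ} (h : ∀ g ∈ P, g.left < g.right)
    (hw : ∀ g ∈ P, g.right ≤ w) : P.before w = P := by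
  have h1 : P.filter (fun g => g.left < w) = P := by
    rw [List.filter_eq_self]
    intro g hg
    simpa using (h g hg).trans_le (hw g hg)
  unfold before
  rw [h1]
  conv_rhs => rw [← List.map_id P]
  refine List.map_congr_left fun g hg => ?_
  rw [min_eq_left (hw g hg)]
  rfl

theorem after_eq_nil {P : Plan} {w : ℝ} (hw : ∀ g ∈ P, g.right ≤ w) : P.after w = [] := by
  simp only [after, List.map_eq_nil_iff, List.filter_eq_nil_iff, decide_eq_true_eq, not_lt]
  exact hw

theorem before_cons (g : Piece) (P : Plan) (w : ℝ) : before (g :: P) w =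
    if g.left < w then ⟨g.job, g.left, min g.right w⟩ :: before P w else before P w := by
  by_cases h : g.left < w <;> simp [before, h]

theorem after_cons (g : Piece) (P : Plan) (w : ℝ) : after (g :: P) w =
    if w < g.right then ⟨g.job, max g.left w, g.right⟩ :: after P w else after P w := by
  by_cases h : w < g.right <;> simp [after, h]

theorem load_before_add_load_after {P : Plan} (h : ∀ g ∈ P, g.left < g.right) (w : ℝ) (j : ℕ) :
    load (P.before w) j + load (P.after w) j = load P j := by
  induction P with
  | nil => simp [before, after]
  | cons g P ih =>
    have hg := h g (by simp)
    have := ih fun g hg => h g (by simp [hg])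
    rw [load_cons, before_cons, after_cons]
    rcases le_or_gt w g.left with h1 | h1
    · rw [if_neg h1.not_gt, if_pos (h1.trans_lt hg), load_cons, max_eq_left h1]
      simp only
      linarith
    · rcases le_or_gt g.right w with h2 | h2
      · rw [if_pos h1, if_neg h2.not_gt, load_cons, min_eq_left h2]
        simp only
        linarith
      · rw [if_pos h1, if_pos h2, load_cons, load_cons, min_eq_right h2.le, max_eq_right h1.le]
        simp only
        split_ifs <;> linarith

/-! #### Schedules without gaps -/

theorem Tiles.eq_add_total {P : Plan} {a b : ℝ} (h : P.Tiles a b) : b = a + P.total := by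
  induction P generalizing a with
  | nil => simp only [Tiles] at h; simp [h]
  | cons g P ih =>
    obtain ⟨h1, -, h3⟩ := h
    rw [ih h3, total_cons]
    linarith

theorem Tiles.proper {P : Plan} {a b : ℝ} (h : P.Tiles a b) : ∀ g ∈ P, g.left < g.right := by
  induction P generalizing a with
  | nil => simp
  | cons k P ih =>
    obtain ⟨-, h2, h3⟩ := h
    intro g hg
    rcases List.mem_cons.1 hg with rfl | hg
    exacts [h2, ih h3 g hg]

theorem Tiles.le {P : Plan} {a b : ℝ} (h : P.Tiles a b) : a ≤ b := by
  induction P generalizing a with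
  | nil => exact le_of_eq h
  | cons k P ih =>
    obtain ⟨h1, h2, h3⟩ := h
    linarith [ih h3]

theorem Tiles.bounds {P : Plan} {a b : ℝ} (h : P.Tiles a b) :
    ∀ g ∈ P, a ≤ g.left ∧ g.right ≤ b := by
  induction P generalizing a with
  | nil => simp
  | cons k P ih =>
    obtain ⟨h1, h2, h3⟩ := h
    intro g hg
    rcases List.mem_cons.1 hg with rfl | hg
    · exact ⟨h1.ge, h3.le⟩
    · have := ih h3 g hg
      exact ⟨by linarith, this.2⟩

theorem Tiles.append {P Q : Plan} {a b c : ℝ} (hP : P.Tiles a b) (hQ : Q.Tiles b c) :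
    (P ++ Q).Tiles a c := by
  induction P generalizing a with
  | nil => simp only [Tiles] at hP; subst hP; exact hQ
  | cons k P ih =>
    obtain ⟨h1, h2, h3⟩ := hP
    exact ⟨h1, h2, ih h3⟩

theorem Tiles.ordered {P : Plan} {a b : ℝ} (h : P.Tiles a b) :
    P.Pairwise (fun g k => g.right ≤ k.left) := by
  induction P generalizing a with
  | nil => simp
  | cons k P ih =>
    obtain ⟨h1, h2, h3⟩ := h
    exact List.pairwise_cons.2 ⟨fun g hg => (h3.bounds g hg).1, ih h3⟩

theorem Tiles.before {P : Plan} {a b w : ℝ} (h : P.Tiles a b) (haw : a ≤ w) (hwb : w ≤ b) :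
    (P.before w).Tiles a w := by
  induction P generalizing a with
  | nil =>
    simp only [Tiles] at h
    simp only [Plan.before, List.filter_nil, List.map_nil, Tiles]
    linarith
  | cons k P ih =>
    obtain ⟨h1, h2, h3⟩ := h
    rw [before_cons]
    rcases le_or_gt w k.right with hw | hw
    · have hnil : Plan.before P w = [] := by
        simp only [Plan.before, List.map_eq_nil_iff, List.filter_eq_nil_iff, decide_eq_true_eq,
          not_lt]
        exact fun g hg => hw.trans (h3.bounds g hg).1
      rw [hnil]
      split_ifs with h4
      · exact ⟨h1, lt_min h2 h4, by simp [Tiles, hw]⟩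
      · simp only [Tiles]; linarith
    · rw [if_pos (h2.trans hw), min_eq_left hw.le]
      exact ⟨h1, h2, ih h3 hw.le⟩

theorem Tiles.after {P : Plan} {a b w : ℝ} (h : P.Tiles a b) (haw : a ≤ w) (hwb : w ≤ b) :
    (P.after w).Tiles w b := by
  induction P generalizing a with
  | nil =>
    simp only [Tiles] at h
    simp only [Plan.after, List.filter_nil, List.map_nil, Tiles]
    linarith
  | cons k P ih =>
    obtain ⟨h1, h2, h3⟩ := h
    rw [after_cons]
    split_ifs with hw
    · have hself : Plan.after P w = P := by
        have hf : P.filter (fun g => w < g.right) = P := by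
          rw [List.filter_eq_self]
          intro g hg
          have := (h3.bounds g hg).1
          have := h3.proper g hg
          simp only [decide_eq_true_eq]
          linarith
        unfold Plan.after
        rw [hf]
        conv_rhs => rw [← List.map_id P]
        refine List.map_congr_left fun g hg => ?_
        rw [max_eq_left (hw.le.trans (h3.bounds g hg).1)]
        rfl
      rw [hself]
      exact ⟨max_eq_right (h1 ▸ haw), max_lt h2 hw, h3⟩
    · exact ih h3 (not_lt.1 hw)

theorem load_layOut (P : Plan) (t : ℝ) (j : ℕ) : load (P.layOut t) j = load P j := by
  induction P generalizing t with
  | nil => rfl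
  | cons g P ih => rw [layOut, load_cons, load_cons, ih]; simp

theorem tiles_layOut {P : Plan} (h : ∀ g ∈ P, g.left < g.right) (t : ℝ) :
    (P.layOut t).Tiles t (t + P.total) := by
  induction P generalizing t with
  | nil => simp [layOut, Tiles]
  | cons g P ih =>
    have hg := h g (by simp)
    refine ⟨rfl, by simp only; linarith, ?_⟩
    have := ih (fun g hg => h g (by simp [hg])) (t + (g.right - g.left))
    rwa [add_assoc, ← total_cons] at this

theorem job_of_mem_layOut {P : Plan} {t : ℝ} {g : Piece} (hg : g ∈ P.layOut t) :
    ∃ k ∈ P, k.job = g.job := by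
  induction P generalizing t with
  | nil => simp [layOut] at hg
  | cons k P ih =>
    rcases List.mem_cons.1 hg with rfl | hg
    · exact ⟨k, by simp, rfl⟩
    · obtain ⟨k', h1, h2⟩ := ih hg
      exact ⟨k', by simp [h1], h2⟩

/-- Laying out a gapless schedule from a time later by `c` postpones every piece by `c`. -/
theorem Tiles.layOut_add {P : Plan} {a b : ℝ} (h : P.Tiles a b) (c : ℝ) :
    P.layOut (a + c) = P.map (fun g => ⟨g.job, g.left + c, g.right + c⟩) := by
  induction P generalizing a with
  | nil => rfl
  | cons k P ih =>
    obtain ⟨h1, h2, h3⟩ := h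
    have h4 : a + c + (k.right - k.left) = k.right + c := by rw [← h1]; ring
    rw [layOut, h4, ih h3, List.map_cons, h1]

/-- Deleting pieces from a schedule before laying it out only brings the others forward. -/
theorem exists_mem_layOut_right_le {P : Plan} (h : ∀ g ∈ P, g.left < g.right) (q : Piece → Bool)
    {t t' : ℝ} (htt : t ≤ t') {g : Piece} (hg : g ∈ layOut (P.filter q) t) :
    ∃ k ∈ P.layOut t', k.job = g.job ∧ g.right ≤ k.right := by
  induction P generalizing t t' with
  | nil => simp [layOut] at hg
  | cons k P ih =>
    have hk := h k (by simp)
    have hP : ∀ g ∈ P, g.left < g.right := fun g hg => h g (by simp [hg])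
    by_cases hq : q k
    · rw [List.filter_cons_of_pos hq, layOut] at hg
      rcases List.mem_cons.1 hg with rfl | hg
      · exact ⟨_, List.mem_cons_self, rfl, by simp only; linarith⟩
      · obtain ⟨k', h1, h2⟩ := ih hP (add_le_add_left htt _) hg
        exact ⟨k', List.mem_cons_of_mem _ h1, h2⟩
    · rw [List.filter_cons_of_neg hq] at hg
      obtain ⟨k', h1, h2⟩ := ih hP (t' := t' + (k.right - k.left)) (by linarith) hg
      exact ⟨k', List.mem_cons_of_mem _ h1, h2⟩

theorem load_filter_job {P : Plan} (q : ℕ → Prop) [DecidablePred q] (j : ℕ) :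
    load (P.filter (fun g => q g.job)) j = if q j then load P j else 0 := by
  induction P with
  | nil => simp
  | cons g P ih =>
    by_cases hq : q g.job
    · rw [List.filter_cons_of_pos (by simpa using hq), load_cons, ih, load_cons]
      by_cases hj : g.job = j
      · subst hj; simp [hq]
      · simp [hj]
    · rw [List.filter_cons_of_neg (by simpa using hq), ih, load_cons]
      by_cases hj : g.job = j
      · subst hj; simp [hq]
      · simp [hj]

theorem finish_eq {P Q : Plan} {a b t : ℝ} (hP : ∀ g ∈ P, g.right ≤ a) (hQ : Q.Tiles a b)
    (hat : a ≤ t) : finish (P ++ Q) t = max t b := by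
  have key : ∀ (L : Plan) (x : ℝ), (∀ g ∈ L, g.right ≤ x) → (L.map Piece.right).foldl max x = x := by
    intro L
    induction L with
    | nil => intro x _; rfl
    | cons g L ih =>
      intro x hx
      rw [List.map_cons, List.foldl_cons, max_eq_left (hx g (by simp))]
      exact ih x fun g hg => hx g (by simp [hg])
  have key2 : ∀ (L : Plan) (a : ℝ), L.Tiles a b → ∀ x, a ≤ x →
      (L.map Piece.right).foldl max x = max x b := by
    intro L
    induction L with
    | nil =>
      intro a h x hx
      simp only [Tiles] at h
      simp [← h, hx]
    | cons g L ih =>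
      intro a h x hx
      obtain ⟨h1, h2, h3⟩ := h
      rw [List.map_cons, List.foldl_cons, ih _ h3 _ (le_max_right _ _), max_assoc,
        max_eq_right h3.le]
  unfold finish
  rw [List.map_append, List.foldl_append, key P t fun g hg => (hP g hg).trans hat]
  exact key2 Q a hQ t hat

/-! #### The processor time given to a job -/

theorem run_eq_of_mem {P : Plan} (hord : P.Pairwise (fun g k => g.right ≤ k.left)) {g : Piece}
    (hg : g ∈ P) {t : ℝ} (h1 : g.left ≤ t) (h2 : t < g.right) : P.run t = some g.job := by
  induction P with
  | nil => simp at hg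
  | cons k P ih =>
    obtain ⟨hk, hP⟩ := List.pairwise_cons.1 hord
    rcases List.mem_cons.1 hg with rfl | hg
    · simp [run, h1, h2]
    · have : ¬ (k.left ≤ t ∧ t < k.right) := fun h => by linarith [hk g hg, h.2]
      have h3 := ih hP hg
      unfold run at h3 ⊢
      rw [List.find?_cons_of_neg (by simpa using this), h3]

/-- Executing a plan without overlaps gives a job that is planned within `[r, d]` at least its load
there. -/
theorem load_le_volume_run {P : Plan} (hord : P.Pairwise (fun g k => g.right ≤ k.left))
    (hpr : ∀ g ∈ P, g.left < g.right) {j : ℕ} {r d : ℝ}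
    (hwin : ∀ g ∈ P, g.job = j → r ≤ g.left ∧ g.right ≤ d) :
    load P j ≤ (volume ({t | P.run t = some j} ∩ Set.Icc r d)).toReal := by
  have key : ∀ Q : Plan, Q.Pairwise (fun g k => g.right ≤ k.left) → (∀ g ∈ Q, g.left < g.right) →
      ENNReal.ofReal (load Q j) ≤ volume (⋃ g ∈ {g | g ∈ Q ∧ g.job = j}, Set.Ico g.left g.right) := by
    intro Q
    induction Q with
    | nil => simp
    | cons k Q ih =>
      intro ho hp
      obtain ⟨hk, hQ⟩ := List.pairwise_cons.1 ho
      have hkk := hp k (by simp)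
      have hp' : ∀ g ∈ Q, g.left < g.right := fun g hg => hp g (by simp [hg])
      have ih' := ih hQ hp'
      rw [load_cons]
      split_ifs with hj
      · have hsub : Set.Ico k.left k.right ∪
            (⋃ g ∈ {g | g ∈ Q ∧ g.job = j}, Set.Ico g.left g.right) ⊆
            ⋃ g ∈ {g | g ∈ k :: Q ∧ g.job = j}, Set.Ico g.left g.right := by
          refine Set.union_subset ?_ ?_
          · exact Set.subset_biUnion_of_mem (u := fun g : Piece => Set.Ico g.left g.right)
              (show k ∈ {g | g ∈ k :: Q ∧ g.job = j} from ⟨by simp, hj⟩)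
          · exact Set.biUnion_subset_biUnion_left fun g hg => ⟨List.mem_cons_of_mem _ hg.1, hg.2⟩
        refine le_trans ?_ (measure_mono hsub)
        rw [measure_union' _ measurableSet_Ico, Real.volume_Ico,
          ENNReal.ofReal_add (by linarith) (load_nonneg hp' j)]
        · gcongr
        · rw [Set.disjoint_left]
          intro t ht ht'
          simp only [Set.mem_iUnion] at ht'
          obtain ⟨g, hg, ht'⟩ := ht'
          have h1 := hk g hg.1
          have h2 := ht.2
          have h3 := ht'.1
          linarith
      · rw [zero_add]
        exact ih'.trans (measure_mono (Set.biUnion_subset_biUnion_left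
          fun g hg => ⟨List.mem_cons_of_mem _ hg.1, hg.2⟩))
  have hfin : volume ({t | P.run t = some j} ∩ Set.Icc r d) ≠ ⊤ :=
    ((measure_mono Set.inter_subset_right).trans_lt (by simp [Real.volume_Icc])).ne
  rw [← ENNReal.ofReal_le_iff_le_toReal hfin]
  refine (key P hord hpr).trans (measure_mono ?_)
  intro t ht
  simp only [Set.mem_iUnion] at ht
  obtain ⟨g, ⟨hg, hj⟩, ht⟩ := ht
  have hw := hwin g hg hj
  refine ⟨?_, by linarith [ht.1, hw.1], by linarith [ht.2, hw.2]⟩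
  have := run_eq_of_mem hord hg ht.1 ht.2
  rwa [hj] at this

end Plan

/-! ### Accepting a job that cannot be appended -/

/-- A tentative schedule whose pieces before `start` belong to jobs with index below `first`, and
whose later pieces fill `[start, endTime)` without gaps and belong to jobs with index at least `first`.
Here `first` is the job whose release began the busy period that is going on, and `start` is its
release time. -/
structure BusyPeriod (P : Plan) (first : ℕ) (start endTime : ℝ) (past cur : Plan) : Prop where
  eq_append : P = past ++ cur
  ordered : past.Pairwise (fun g k => g.right ≤ k.left)
  past_right : ∀ g ∈ past, g.right ≤ start
  past_job : ∀ g ∈ past, g.job < first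
  tiles : cur.Tiles start endTime
  cur_job : ∀ g ∈ cur, first ≤ g.job

theorem BusyPeriod.pairwise {P past cur : Plan} {m : ℕ} {a b : ℝ}
    (h : BusyPeriod P m a b past cur) : P.Pairwise (fun g k => g.right ≤ k.left) := by
  rw [h.eq_append, List.pairwise_append]
  exact ⟨h.ordered, h.tiles.ordered, fun g hg k hk =>
    (h.past_right g hg).trans (h.tiles.bounds k hk).1⟩

theorem BusyPeriod.right_le {P past cur : Plan} {m : ℕ} {a b : ℝ}
    (h : BusyPeriod P m a b past cur) : ∀ g ∈ P, g.right ≤ b := by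
  intro g hg
  rw [h.eq_append, List.mem_append] at hg
  rcases hg with hg | hg
  · exact (h.past_right g hg).trans h.tiles.le
  · exact (h.tiles.bounds g hg).2

theorem BusyPeriod.first_le {P past cur : Plan} {m : ℕ} {a b : ℝ}
    (h : BusyPeriod P m a b past cur) {g : Piece} (hg : g ∈ P) (hr : a < g.right) :
    m ≤ g.job := by
  rw [h.eq_append, List.mem_append] at hg
  rcases hg with hg | hg
  · exact absurd (h.past_right g hg) hr.not_ge
  · exact h.cur_job g hg

/-- The length of the busy period is the load of its jobs. -/
theorem BusyPeriod.length_eq {P past cur : Plan} {m n : ℕ} {a b : ℝ}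
    (h : BusyPeriod P m a b past cur) (hn : ∀ g ∈ P, g.job < n) :
    b - a = ∑ i ∈ (Finset.range n).filter (m ≤ ·), P.load i := by
  have hc : ∀ g ∈ cur, g.job < n := fun g hg => hn g (by rw [h.eq_append]; simp [hg])
  rw [h.tiles.eq_add_total, Plan.total_eq_sum_load hc, Finset.sum_filter, add_sub_cancel_left]
  refine Finset.sum_congr rfl fun i _ => ?_
  rw [h.eq_append, Plan.load_append]
  split_ifs with hi
  · rw [Plan.load_eq_zero (P := past), zero_add]
    intro g hg hgi
    have := h.past_job g hg
    omega
  · apply Plan.load_eq_zero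
    intro g hg hgi
    have := h.cur_job g hg
    omega

namespace DSCState

/-- The `j`-th job released so far. -/
noncomputable def job (s : DSCState) (j : ℕ) : Job := s.seen.getD j ⟨0, 0, 0⟩

theorem getElem?_seen (s : DSCState) {j : ℕ} (hj : j < s.seen.length) :
    s.seen[j]? = some (s.job j) := by
  simp [job, List.getD, hj]

theorem getElem_seen (s : DSCState) {j : ℕ} (hj : j < s.seen.length) :
    s.seen[j] = s.job j := by
  simp [job, List.getD, hj]

theorem job_mem (s : DSCState) {j : ℕ} (hj : j < s.seen.length) : s.job j ∈ s.seen := by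
  rw [← s.getElem_seen hj]
  exact List.getElem_mem _

/-- What DSC maintains about its tentative schedule: a job is planned only within its window, and
for no longer than its processing time. -/
structure Sound (s : DSCState) : Prop where
  proper : ∀ g ∈ s.plan, g.left < g.right
  job_lt : ∀ g ∈ s.plan, g.job < s.seen.length
  admitted_of_mem : ∀ g ∈ s.plan, s.admitted g.job
  admitted_lt : ∀ j, s.admitted j → j < s.seen.length
  release_le : ∀ g ∈ s.plan, (s.job g.job).release ≤ g.left
  right_le : ∀ g ∈ s.plan, g.right ≤ (s.job g.job).deadline
  load_le : ∀ j < s.seen.length, s.plan.load j ≤ (s.job j).proc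
  proc_pos : ∀ j < s.seen.length, 0 < (s.job j).proc

open Classical in
/-- The jobs that are anticipated to be completed. -/
noncomputable def completing (s : DSCState) : Finset ℕ :=
  (Finset.range s.seen.length).filter (fun j => (s.job j).proc ≤ s.plan.load j)

theorem mem_completing {s : DSCState} {j : ℕ} :
    j ∈ s.completing ↔ j < s.seen.length ∧ (s.job j).proc ≤ s.plan.load j := by
  simp [completing]

theorem completes_iff {s : DSCState} {P : Plan} {j : ℕ} :
    s.Completes P j ↔
      j < s.seen.length ∧ (s.job j).proc ≤ P.processedBy j (s.job j).deadline := by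
  constructor
  · rintro ⟨K, hK, h⟩
    obtain ⟨hj, rfl⟩ := List.getElem?_eq_some_iff.1 hK
    rw [s.getElem_seen hj] at h
    exact ⟨hj, h⟩
  · rintro ⟨hj, h⟩
    exact ⟨_, s.getElem?_seen hj, h⟩

open Classical in
/-- The jobs that lose processing if the new job `J` is accepted without being appended. -/
noncomputable def lost (s : DSCState) (J : Job) : Finset ℕ :=
  (Finset.range s.seen.length).filter
    (fun j => 0 < (s.plan.after (J.deadline - J.proc)).load j ∧ ¬ s.Completes (s.moved J) j)

theorem mem_lost {s : DSCState} {J : Job} {j : ℕ} :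
    j ∈ s.lost J ↔ j < s.seen.length ∧ 0 < (s.plan.after (J.deadline - J.proc)).load j ∧
      ¬ s.Completes (s.moved J) j := by
  simp [lost]

namespace Sound

variable {s : DSCState}

theorem load_new (h : s.Sound) : s.plan.load s.seen.length = 0 :=
  Plan.load_eq_zero fun g hg => (h.job_lt g hg).ne

theorem load_of_mem_completing (h : s.Sound) {j : ℕ} (hj : j ∈ s.completing) :
    s.plan.load j = (s.job j).proc :=
  le_antisymm (h.load_le j (mem_completing.1 hj).1) (mem_completing.1 hj).2

theorem processedBy_eq (h : s.Sound) (j : ℕ) :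
    s.plan.processedBy j (s.job j).deadline = s.plan.load j :=
  Plan.processedBy_eq_load fun g hg hj => ⟨h.proper g hg, hj ▸ h.right_le g hg⟩

theorem completes_plan_iff (h : s.Sound) {j : ℕ} : s.Completes s.plan j ↔ j ∈ s.completing := by
  rw [completes_iff, mem_completing, h.processedBy_eq]

theorem load_split (h : s.Sound) (w : ℝ) (j : ℕ) :
    (s.plan.before w).load j + (s.plan.after w).load j = s.plan.load j :=
  Plan.load_before_add_load_after h.proper w j

theorem load_before_nonneg (h : s.Sound) (w : ℝ) (j : ℕ) : 0 ≤ (s.plan.before w).load j :=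
  Plan.load_nonneg (Plan.before_proper h.proper w) j

theorem load_after_nonneg (h : s.Sound) (w : ℝ) (j : ℕ) : 0 ≤ (s.plan.after w).load j :=
  Plan.load_nonneg (Plan.after_proper h.proper w) j

theorem load_after_pos (h : s.Sound) {w : ℝ} {g : Piece} (hg : g ∈ s.plan) (hw : w < g.right) :
    0 < (s.plan.after w).load g.job :=
  Plan.load_pos (g := ⟨g.job, max g.left w, g.right⟩) (Plan.after_proper h.proper w)
    (Plan.mk_mem_after hg hw)

theorem exists_of_load_after_pos {w : ℝ} {j : ℕ} (hj : 0 < (s.plan.after w).load j) :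
    ∃ g ∈ s.plan, g.job = j ∧ w < g.right := by
  obtain ⟨g, hg, rfl⟩ := Plan.exists_mem_of_load_pos hj
  obtain ⟨k, hk, h1, -, h3, -⟩ := Plan.mem_after hg
  exact ⟨k, hk, h1.symm, h3⟩

variable {J : Job}

theorem moved_proper (h : s.Sound) (hJ : 0 < J.proc) : ∀ g ∈ s.moved J, g.left < g.right := by
  intro g hg
  simp only [moved, List.append_assoc, List.mem_append, List.mem_singleton] at hg
  rcases hg with hg | rfl | hg
  · exact Plan.before_proper h.proper _ g hg
  · simp only; linarith
  · exact (Plan.tiles_layOut (Plan.after_proper h.proper _) _).proper g hg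

theorem load_moved (h : s.Sound) {j : ℕ} (hj : j < s.seen.length) :
    (s.moved J).load j = s.plan.load j := by
  rw [moved, Plan.load_append, Plan.load_append, Plan.load_layOut, Plan.load_cons,
    if_neg (by simpa using hj.ne'), Plan.load_nil, ← h.load_split (J.deadline - J.proc) j]
  ring

theorem moved_right_le (h : s.Sound) (hJ : 0 < J.proc) {j : ℕ} (hj : s.Completes (s.moved J) j) :
    ∀ g ∈ s.moved J, g.job = j → g.right ≤ (s.job j).deadline := by
  obtain ⟨hlt, hc⟩ := completes_iff.1 hj
  refine Plan.right_le_of_load_le (h.moved_proper hJ) ?_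
  rw [h.load_moved hlt]
  exact (h.load_le j hlt).trans hc

theorem mem_completing_of_completes_moved (h : s.Sound) (hJ : 0 < J.proc) {j : ℕ}
    (hj : s.Completes (s.moved J) j) : j ∈ s.completing := by
  obtain ⟨hlt, hc⟩ := completes_iff.1 hj
  rw [mem_completing, ← h.load_moved (J := J) hlt]
  exact ⟨hlt, hc.trans (Plan.processedBy_le_load (h.moved_proper hJ) _ _)⟩

theorem mem_contend (h : s.Sound) {g : Piece} (hg : g ∈ s.contend J) :
    g ∈ s.plan.before (J.deadline - J.proc) ∨
      g = ⟨s.seen.length, J.deadline - J.proc, J.deadline⟩ ∨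
      J.deadline ≤ g.left ∧ g.left < g.right ∧ s.Completes (s.moved J) g.job ∧
        (∃ k ∈ s.plan, k.job = g.job) ∧ ∃ k ∈ s.moved J, k.job = g.job ∧ g.right ≤ k.right := by
  simp only [contend, List.append_assoc, List.mem_append, List.mem_singleton] at hg
  rcases hg with hg | hg | hg
  · exact Or.inl hg
  · exact Or.inr (Or.inl hg)
  · refine Or.inr (Or.inr ?_)
    have hpr := Plan.after_proper h.proper (J.deadline - J.proc)
    obtain ⟨k, hk, hkg⟩ := Plan.job_of_mem_layOut hg
    obtain ⟨hk1, hk2⟩ := List.mem_filter.1 hk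
    obtain ⟨k', hk', h3, -⟩ := Plan.mem_after hk1
    refine ⟨((Plan.tiles_layOut ?_ _).bounds g hg).1, (Plan.tiles_layOut ?_ _).proper g hg, ?_,
      ⟨k', hk', h3 ▸ hkg⟩, ?_⟩
    · exact fun k hk => hpr k (List.mem_of_mem_filter hk)
    · exact fun k hk => hpr k (List.mem_of_mem_filter hk)
    · rw [← hkg]
      simpa using hk2
    · obtain ⟨k, hk, h1, h2⟩ := Plan.exists_mem_layOut_right_le hpr _ le_rfl hg
      exact ⟨k, by simp [moved, hk], h1, h2⟩

open Classical in
theorem load_contend {j : ℕ} (hj : j < s.seen.length) :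
    (s.contend J).load j = (s.plan.before (J.deadline - J.proc)).load j +
      if s.Completes (s.moved J) j then (s.plan.after (J.deadline - J.proc)).load j else 0 := by
  rw [contend, Plan.load_append, Plan.load_append, Plan.load_layOut, Plan.load_cons,
    if_neg (by simpa using hj.ne'), Plan.load_nil, add_zero, add_zero,
    ← Plan.load_filter_job (fun i => s.Completes (s.moved J) i)]

theorem load_contend_add (h : s.Sound) {j : ℕ} (hj : j < s.seen.length) :
    (s.contend J).load j + (if j ∈ s.lost J then
      (s.plan.after (J.deadline - J.proc)).load j else 0) = s.plan.load j := by
  classical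
  rw [load_contend hj, ← h.load_split (J.deadline - J.proc) j]
  have h0 := h.load_after_nonneg (J.deadline - J.proc) j
  by_cases hc : s.Completes (s.moved J) j
  · simp [mem_lost, hc]
  · rcases h0.lt_or_eq with hp | hp
    · simp [mem_lost, hc, hp, hj]
    · simp [mem_lost, hc, hp.symm]

theorem load_contend_le (h : s.Sound) {j : ℕ} (hj : j < s.seen.length) :
    (s.contend J).load j ≤ s.plan.load j := by
  have h1 := h.load_contend_add (J := J) hj
  have h2 := h.load_after_nonneg (J.deadline - J.proc) j
  split_ifs at h1 <;> linarith

theorem load_contend_lt (h : s.Sound) {j : ℕ} (hj : j ∈ s.lost J) :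
    (s.contend J).load j < s.plan.load j := by
  have h1 := h.load_contend_add (J := J) (mem_lost.1 hj).1
  have h2 := (mem_lost.1 hj).2.1
  rw [if_pos hj] at h1
  linarith

theorem load_contend_eq (h : s.Sound) {j : ℕ} (hj : j < s.seen.length) (hl : j ∉ s.lost J) :
    (s.contend J).load j = s.plan.load j := by
  have h1 := h.load_contend_add (J := J) hj
  rw [if_neg hl] at h1
  linarith

theorem load_contend_new (h : s.Sound) : (s.contend J).load s.seen.length = J.proc := by
  classical
  have hb : (s.plan.before (J.deadline - J.proc)).load s.seen.length = 0 := by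
    have := h.load_split (J.deadline - J.proc) s.seen.length
    have h1 := h.load_before_nonneg (J.deadline - J.proc) s.seen.length
    have h2 := h.load_after_nonneg (J.deadline - J.proc) s.seen.length
    linarith [h.load_new]
  have hc : ¬ s.Completes (s.moved J) s.seen.length := fun hc => by
    simpa using (completes_iff.1 hc).1
  rw [contend, Plan.load_append, Plan.load_append, Plan.load_layOut, Plan.load_cons,
    if_pos rfl, Plan.load_nil, hb]
  have := Plan.load_filter_job (P := s.plan.after (J.deadline - J.proc))
    (fun i => s.Completes (s.moved J) i) s.seen.length
  rw [this, if_neg hc]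
  simp

theorem contend_proper (h : s.Sound) (hJ : 0 < J.proc) : ∀ g ∈ s.contend J, g.left < g.right := by
  intro g hg
  rcases h.mem_contend hg with hg | rfl | hg
  · exact Plan.before_proper h.proper _ g hg
  · simp only; linarith
  · exact hg.2.1

theorem contend_right_le (h : s.Sound) (hJ : 0 < J.proc) {g : Piece} (hg : g ∈ s.contend J)
    (hj : g.job < s.seen.length) : g.right ≤ (s.job g.job).deadline := by
  rcases h.mem_contend hg with hg | rfl | ⟨-, -, h1, -, k, hk, h2, h3⟩
  · obtain ⟨k, hk, h1, -, -, h4⟩ := Plan.mem_before hg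
    rw [h4, h1]
    exact (min_le_left _ _).trans (h.right_le k hk)
  · simp at hj
  · exact h3.trans (h.moved_right_le hJ h1 k hk h2)

theorem processedBy_contend (h : s.Sound) (hJ : 0 < J.proc) {j : ℕ} (hj : j < s.seen.length) :
    (s.contend J).processedBy j (s.job j).deadline = (s.contend J).load j := by
  apply Plan.processedBy_eq_load
  rintro g hg rfl
  exact ⟨h.contend_proper hJ g hg, h.contend_right_le hJ hg hj⟩

theorem affected_iff (h : s.Sound) (hJ : 0 < J.proc) (j : Fin s.seen.length) :
    j ∈ s.affected J ↔ (j : ℕ) ∈ s.lost J := by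
  simp only [affected, Finset.mem_filter, Finset.mem_univ, true_and, Fin.getElem_fin]
  rw [s.getElem_seen j.2, h.processedBy_contend hJ j.2, h.processedBy_eq]
  constructor
  · intro hlt
    by_contra hl
    exact hlt.ne (h.load_contend_eq j.2 hl)
  · exact h.load_contend_lt

theorem sum_affected (h : s.Sound) (hJ : 0 < J.proc) (f : ℕ → ℝ) :
    ∑ j ∈ s.affected J, f j = ∑ j ∈ s.lost J, f j := by
  classical
  have : (s.affected J).map Fin.valEmbedding = s.lost J := by
    ext j
    simp only [Finset.mem_map, Fin.valEmbedding_apply]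
    constructor
    · rintro ⟨i, hi, rfl⟩
      exact (h.affected_iff hJ i).1 hi
    · intro hj
      exact ⟨⟨j, (mem_lost.1 hj).1⟩, (h.affected_iff hJ _).2 hj, rfl⟩
  rw [← this, Finset.sum_map]
  rfl

theorem sum_ousted (h : s.Sound) (hJ : 0 < J.proc) (f : ℕ → ℝ) :
    ∑ j ∈ s.ousted J, f j = ∑ j ∈ s.lost J ∩ s.completing, f j := by
  classical
  have h1 := h.sum_affected hJ fun j => if j ∈ s.completing then f j else 0
  rw [← Finset.sum_filter, ← Finset.sum_filter, Finset.filter_mem_eq_inter] at h1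
  rw [← h1]
  refine Finset.sum_congr ?_ fun _ _ => rfl
  ext j
  simp only [ousted, Finset.mem_filter, h.completes_plan_iff]

theorem penaltyAccept_eq (h : s.Sound) (hJ : 0 < J.proc) :
    s.penaltyAccept J = ∑ j ∈ s.lost J, (s.plan.load j - (s.contend J).load j) +
      ∑ j ∈ s.lost J ∩ s.completing, s.charge j := by
  rw [penaltyAccept, h.sum_ousted hJ s.charge, ← h.sum_affected hJ]
  congr 1
  refine Finset.sum_congr rfl fun j _ => ?_
  rw [Fin.getElem_fin, s.getElem_seen j.2, h.processedBy_contend hJ j.2, h.processedBy_eq]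

theorem profitDecline_eq (h : s.Sound) (hJ : 0 < J.proc) :
    s.profitDecline J = ∑ j ∈ s.lost J ∩ s.completing, ((s.job j).proc - s.charge j) := by
  rw [← h.sum_ousted hJ fun j => (s.job j).proc - s.charge j, profitDecline]
  refine Finset.sum_congr rfl fun j _ => ?_
  rw [Fin.getElem_fin, s.getElem_seen j.2, Job.value]

/-- A job planned up to its deadline does not survive being moved. -/
theorem not_completes_moved_of_tight (h : s.Sound) (hJ : 0 < J.proc) {m : ℕ} {a e : ℝ}
    {past cur : Plan} (hB : BusyPeriod s.plan m a e past cur) (haw : a ≤ J.deadline - J.proc)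
    (hwe : J.deadline - J.proc ≤ e) {g : Piece} (hg : g ∈ s.plan)
    (hw : J.deadline - J.proc < g.right) (ht : g.right = (s.job g.job).deadline) :
    ¬ s.Completes (s.moved J) g.job := by
  intro hc
  have hafter : (s.plan.after (J.deadline - J.proc)).Tiles (J.deadline - J.proc) e := by
    rw [hB.eq_append, Plan.after_append,
      Plan.after_eq_nil fun g hg => (hB.past_right g hg).trans haw, List.nil_append]
    exact hB.tiles.after haw hwe
  have hmem : (⟨g.job, max g.left (J.deadline - J.proc) + J.proc, g.right + J.proc⟩ : Piece) ∈
      s.moved J := by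
    have := hafter.layOut_add J.proc
    rw [sub_add_cancel] at this
    simp only [moved, List.append_assoc, List.mem_append]
    rw [this]
    exact Or.inr (Or.inr (List.mem_map.2 ⟨_, Plan.mk_mem_after hg hw, rfl⟩))
  have := h.moved_right_le hJ hc _ hmem rfl
  simp only at this
  linarith

/-- Every job whose deadline is not before the end of the moved schedule survives the move. -/
theorem deadline_lt_of_lost (h : s.Sound) (hJ : 0 < J.proc) {m : ℕ} {a e : ℝ}
    {past cur : Plan} (hB : BusyPeriod s.plan m a e past cur) (haw : a ≤ J.deadline - J.proc)
    (hwe : J.deadline - J.proc ≤ e) {j : ℕ} (hl : j ∈ s.lost J) (hc : j ∈ s.completing) :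
    (s.job j).deadline < e + J.proc := by
  by_contra! hd
  have hj := (mem_completing.1 hc).1
  refine (mem_lost.1 hl).2.2 (completes_iff.2 ⟨hj, ?_⟩)
  rw [Plan.processedBy_eq_load, h.load_moved hj]
  · exact (mem_completing.1 hc).2
  rintro g hg rfl
  refine ⟨h.moved_proper hJ g hg, ?_⟩
  simp only [moved, List.append_assoc, List.mem_append, List.mem_singleton] at hg
  rcases hg with hg | rfl | hg
  · obtain ⟨k, hk, h1, -, -, h4⟩ := Plan.mem_before hg
    rw [h4, h1]
    exact (min_le_left _ _).trans (h.right_le k hk)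
  · simp at hj
  · have hafter : (s.plan.after (J.deadline - J.proc)).Tiles (J.deadline - J.proc) e := by
      rw [hB.eq_append, Plan.after_append,
        Plan.after_eq_nil fun g hg => (hB.past_right g hg).trans haw, List.nil_append]
      exact hB.tiles.after haw hwe
    have h1 := ((Plan.tiles_layOut hafter.proper J.deadline).bounds g hg).2
    have h2 := hafter.eq_add_total
    linarith

/-- The losses do not exceed the part of the schedule after the cut. -/
theorem sum_lost_le (h : s.Sound) {m : ℕ} {a e : ℝ}
    {past cur : Plan} (hB : BusyPeriod s.plan m a e past cur) (haw : a ≤ J.deadline - J.proc)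
    (hwe : J.deadline - J.proc ≤ e) :
    ∑ j ∈ s.lost J, (s.plan.load j - (s.contend J).load j) ≤ e - (J.deadline - J.proc) := by
  have hafter : (s.plan.after (J.deadline - J.proc)).Tiles (J.deadline - J.proc) e := by
    rw [hB.eq_append, Plan.after_append,
      Plan.after_eq_nil fun g hg => (hB.past_right g hg).trans haw, List.nil_append]
    exact hB.tiles.after haw hwe
  have hlt : ∀ g ∈ s.plan.after (J.deadline - J.proc), g.job < s.seen.length := by
    intro g hg
    obtain ⟨k, hk, h1, -⟩ := Plan.mem_after hg
    rw [h1]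
    exact h.job_lt k hk
  have h1 := hafter.eq_add_total
  rw [Plan.total_eq_sum_load hlt] at h1
  have h2 : ∑ j ∈ s.lost J, (s.plan.load j - (s.contend J).load j) ≤
      ∑ j ∈ Finset.range s.seen.length, (s.plan.after (J.deadline - J.proc)).load j := by
    refine (Finset.sum_le_sum (g := (s.plan.after (J.deadline - J.proc)).load) ?_).trans
      (Finset.sum_le_sum_of_subset_of_nonneg (fun j hj => Finset.mem_range.2 (mem_lost.1 hj).1)
        fun j _ _ => h.load_after_nonneg _ j)
    intro j hj
    have := h.load_contend_add (J := J) (mem_lost.1 hj).1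
    rw [if_pos hj] at this
    linarith
  linarith

/-- Accepting `J` keeps the busy period free of gaps, and prolongs it by at most the processing time
of `J`. -/
theorem exists_busyPeriod_contend (h : s.Sound) (hJ : 0 < J.proc) {m : ℕ} {a e : ℝ}
    {past cur : Plan} (hB : BusyPeriod s.plan m a e past cur) (haw : a ≤ J.deadline - J.proc)
    (hwe : J.deadline - J.proc ≤ e) (hm : m ≤ s.seen.length) :
    ∃ e' cur', BusyPeriod (s.contend J) m a e' past cur' ∧ e' ≤ e + J.proc := by
  classical
  have hpast : ∀ g ∈ past, g.right ≤ J.deadline - J.proc :=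
    fun g hg => (hB.past_right g hg).trans haw
  have hpp : ∀ g ∈ past, g.left < g.right := fun g hg => h.proper g (by rw [hB.eq_append]; simp [hg])
  have hafter : s.plan.after (J.deadline - J.proc) = cur.after (J.deadline - J.proc) := by
    rw [hB.eq_append, Plan.after_append, Plan.after_eq_nil hpast, List.nil_append]
  have hbefore : s.plan.before (J.deadline - J.proc) =
      past ++ cur.before (J.deadline - J.proc) := by
    rw [hB.eq_append, Plan.before_append, Plan.before_eq_self hpp hpast]
  have ht := hB.tiles.after haw hwe
  set Q : Plan := (cur.after (J.deadline - J.proc)).filter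
    (fun g => s.Completes (s.moved J) g.job) with hQ
  have hQp : ∀ g ∈ Q, g.left < g.right := fun g hg => ht.proper g (List.mem_of_mem_filter hg)
  refine ⟨J.deadline + Q.total, cur.before (J.deadline - J.proc) ++
    ([⟨s.seen.length, J.deadline - J.proc, J.deadline⟩] ++ Q.layOut J.deadline), ⟨?_, hB.ordered,
      hB.past_right, hB.past_job, ?_, ?_⟩, ?_⟩
  · rw [contend, hafter, hbefore]
    simp [hQ]
  · refine (hB.tiles.before haw hwe).append (Plan.Tiles.append (b := J.deadline) ?_
      (Plan.tiles_layOut hQp _))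
    exact ⟨rfl, by simp only; linarith, rfl⟩
  · intro g hg
    rcases List.mem_append.1 hg with hg | hg
    · obtain ⟨k, hk, h1, -⟩ := Plan.mem_before hg
      rw [h1]
      exact hB.cur_job k hk
    · rcases List.mem_append.1 hg with hg | hg
      · rw [List.mem_singleton] at hg
        rw [hg]
        exact hm
      · obtain ⟨k, hk, h1⟩ := Plan.job_of_mem_layOut hg
        obtain ⟨k', hk', h2, -⟩ := Plan.mem_after (List.mem_of_mem_filter hk)
        rw [← h1, h2]
        exact hB.cur_job k' hk'
  · have h1 := ht.eq_add_total
    have h2 : Q.total ≤ (cur.after (J.deadline - J.proc)).total := by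
      refine List.Sublist.sum_le_sum ((List.filter_sublist).map _) ?_
      intro x hx
      obtain ⟨g, hg, rfl⟩ := List.mem_map.1 hx
      have := ht.proper g hg
      linarith
    linarith

end Sound

end DSCState

/-! ### The three reactions of DSC -/

namespace DSCState

/-- The state after the new job `J` is declined. -/
def decline (s : DSCState) (J : Job) : DSCState := { s with seen := s.seen ++ [J] }

/-- The state after the new job `J` is appended at time `e`. -/
noncomputable def append (s : DSCState) (J : Job) (e : ℝ) : DSCState where
  seen := s.seen ++ [J]
  plan := s.plan ++ [⟨s.seen.length, e, e + J.proc⟩]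
  admitted := fun k => k = s.seen.length ∨ s.admitted k
  charge := Function.update s.charge s.seen.length 0

/-- The state after the new job `J` is accepted without being appended. -/
noncomputable def accept (s : DSCState) (J : Job) : DSCState where
  seen := s.seen ++ [J]
  plan := s.contend J
  admitted := fun k => k = s.seen.length ∨ s.admitted k
  charge := Function.update s.charge s.seen.length (s.penaltyAccept J)

open Classical in
theorem step_eq (β : ℝ) (s : DSCState) (J : Job) :
    step β s J = if s.plan.finish J.release + J.proc ≤ J.deadline then
        s.append J (s.plan.finish J.release)
      else if s.profitAccept J > (1 + β) * s.profitDecline J then s.accept J else s.decline J :=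
  rfl

theorem job_of_seen_eq {s s' : DSCState} {J : Job} (hs : s'.seen = s.seen ++ [J]) {j : ℕ}
    (hj : j < s.seen.length) : s'.job j = s.job j := by
  simp [job, hs, List.getD, List.getElem?_append_left hj]

theorem job_length_of_seen_eq {s s' : DSCState} {J : Job} (hs : s'.seen = s.seen ++ [J]) :
    s'.job s.seen.length = J := by
  simp [job, hs, List.getD]

theorem length_of_seen_eq {s s' : DSCState} {J : Job} (hs : s'.seen = s.seen ++ [J]) :
    s'.seen.length = s.seen.length + 1 := by
  simp [hs]

theorem Sound.decline {s : DSCState} (h : s.Sound) {J : Job} (hJ : 0 < J.proc) :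
    (s.decline J).Sound := by
  have hs : (s.decline J).seen = s.seen ++ [J] := rfl
  have hl := length_of_seen_eq hs
  refine ⟨h.proper, fun g hg => by have := h.job_lt g hg; omega, h.admitted_of_mem,
    fun j hj => by have := h.admitted_lt j hj; omega, ?_, ?_, ?_, ?_⟩
  · intro g hg
    rw [job_of_seen_eq hs (h.job_lt g hg)]
    exact h.release_le g hg
  · intro g hg
    rw [job_of_seen_eq hs (h.job_lt g hg)]
    exact h.right_le g hg
  · intro j hj
    rcases Nat.lt_succ_iff_lt_or_eq.1 (hl ▸ hj) with hj | rfl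
    · rw [job_of_seen_eq hs hj]
      exact h.load_le j hj
    · rw [job_length_of_seen_eq hs]
      exact h.load_new.le.trans hJ.le
  · intro j hj
    rcases Nat.lt_succ_iff_lt_or_eq.1 (hl ▸ hj) with hj | rfl
    · rw [job_of_seen_eq hs hj]
      exact h.proc_pos j hj
    · rwa [job_length_of_seen_eq hs]

theorem load_append_plan {s : DSCState} (J : Job) (e : ℝ) {j : ℕ} (hj : j < s.seen.length) :
    (s.append J e).plan.load j = s.plan.load j := by
  rw [append, Plan.load_append, Plan.load_cons, if_neg (by simpa using hj.ne')]
  simp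

theorem Sound.load_append_new {s : DSCState} (h : s.Sound) (J : Job) (e : ℝ) :
    (s.append J e).plan.load s.seen.length = J.proc := by
  rw [DSCState.append, Plan.load_append, Plan.load_cons, if_pos rfl, h.load_new]
  simp

theorem Sound.append {s : DSCState} (h : s.Sound) {J : Job} (hJ : 0 < J.proc) {e : ℝ}
    (hr : J.release ≤ e) (hd : e + J.proc ≤ J.deadline) : (s.append J e).Sound := by
  have hs : (s.append J e).seen = s.seen ++ [J] := rfl
  have hl := length_of_seen_eq hs
  have hmem : ∀ g ∈ (s.append J e).plan,
      g ∈ s.plan ∨ g = ⟨s.seen.length, e, e + J.proc⟩ := fun g hg => by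
    simpa [DSCState.append] using hg
  refine ⟨?_, ?_, ?_, ?_, ?_, ?_, ?_, ?_⟩
  · intro g hg
    rcases hmem g hg with hg | rfl
    · exact h.proper g hg
    · simpa using hJ
  · intro g hg
    rcases hmem g hg with hg | rfl
    · have := h.job_lt g hg; omega
    · simp [hl]
  · intro g hg
    rcases hmem g hg with hg | rfl
    · exact Or.inr (h.admitted_of_mem g hg)
    · exact Or.inl rfl
  · rintro j (rfl | hj)
    · omega
    · have := h.admitted_lt j hj; omega
  · intro g hg
    rcases hmem g hg with hg | rfl
    · rw [job_of_seen_eq hs (h.job_lt g hg)]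
      exact h.release_le g hg
    · rwa [job_length_of_seen_eq hs]
  · intro g hg
    rcases hmem g hg with hg | rfl
    · rw [job_of_seen_eq hs (h.job_lt g hg)]
      exact h.right_le g hg
    · rwa [job_length_of_seen_eq hs]
  · intro j hj
    rcases Nat.lt_succ_iff_lt_or_eq.1 (hl ▸ hj) with hj | rfl
    · rw [job_of_seen_eq hs hj, load_append_plan J e hj]
      exact h.load_le j hj
    · rw [job_length_of_seen_eq hs, h.load_append_new]
  · intro j hj
    rcases Nat.lt_succ_iff_lt_or_eq.1 (hl ▸ hj) with hj | rfl
    · rw [job_of_seen_eq hs hj]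
      exact h.proc_pos j hj
    · rwa [job_length_of_seen_eq hs]

theorem Sound.accept {s : DSCState} (h : s.Sound) {J : Job} (hJ : 0 < J.proc)
    (hw : J.release + J.proc ≤ J.deadline) (hr : ∀ K ∈ s.seen, K.release ≤ J.release) :
    (s.accept J).Sound := by
  have hs : (s.accept J).seen = s.seen ++ [J] := rfl
  have hl := length_of_seen_eq hs
  have hmem : ∀ g ∈ s.contend J, g.job = s.seen.length ∧
      g = ⟨s.seen.length, J.deadline - J.proc, J.deadline⟩ ∨
      (∃ k ∈ s.plan, k.job = g.job) ∧ (s.job g.job).release ≤ g.left := by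
    intro g hg
    rcases h.mem_contend hg with hg | rfl | ⟨h1, -, -, ⟨k, hk, h2⟩, -⟩
    · obtain ⟨k, hk, h1, h2, -⟩ := Plan.mem_before hg
      refine Or.inr ⟨⟨k, hk, h1.symm⟩, ?_⟩
      rw [h1, h2]
      exact h.release_le k hk
    · exact Or.inl ⟨rfl, rfl⟩
    · refine Or.inr ⟨⟨k, hk, h2⟩, ?_⟩
      have := hr _ (s.job_mem (h2 ▸ h.job_lt k hk))
      linarith
  refine ⟨h.contend_proper hJ, ?_, ?_, ?_, ?_, ?_, ?_, ?_⟩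
  · intro g hg
    rcases hmem g hg with ⟨h1, -⟩ | ⟨⟨k, hk, h1⟩, -⟩
    · omega
    · have := h.job_lt k hk; omega
  · intro g hg
    rcases hmem g hg with ⟨h1, -⟩ | ⟨⟨k, hk, h1⟩, -⟩
    · exact Or.inl h1
    · exact Or.inr (h1 ▸ h.admitted_of_mem k hk)
  · rintro j (rfl | hj)
    · omega
    · have := h.admitted_lt j hj; omega
  · intro g hg
    rcases hmem g hg with ⟨-, rfl⟩ | ⟨⟨k, hk, h1⟩, h2⟩
    · rw [job_length_of_seen_eq hs]
      simp only
      linarith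
    · rwa [job_of_seen_eq hs (h1 ▸ h.job_lt k hk)]
  · intro g hg
    rcases hmem g hg with ⟨-, rfl⟩ | ⟨⟨k, hk, h1⟩, h2⟩
    · rw [job_length_of_seen_eq hs]
    · have hlt := h1 ▸ h.job_lt k hk
      rw [job_of_seen_eq hs hlt]
      exact h.contend_right_le hJ hg hlt
  · intro j hj
    rcases Nat.lt_succ_iff_lt_or_eq.1 (hl ▸ hj) with hj | rfl
    · rw [job_of_seen_eq hs hj]
      exact (h.load_contend_le hj).trans (h.load_le j hj)
    · rw [job_length_of_seen_eq hs]
      exact h.load_contend_new.le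
  · intro j hj
    rcases Nat.lt_succ_iff_lt_or_eq.1 (hl ▸ hj) with hj | rfl
    · rw [job_of_seen_eq hs hj]
      exact h.proc_pos j hj
    · rwa [job_length_of_seen_eq hs]

theorem Sound.completing_decline {s : DSCState} (h : s.Sound) {J : Job} (hJ : 0 < J.proc) :
    (s.decline J).completing = s.completing := by
  have hs : (s.decline J).seen = s.seen ++ [J] := rfl
  ext j
  rw [mem_completing, mem_completing, length_of_seen_eq hs, Nat.lt_succ_iff_lt_or_eq]
  constructor
  · rintro ⟨hj | rfl, h1⟩
    · rw [job_of_seen_eq hs hj] at h1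
      exact ⟨hj, h1⟩
    · rw [job_length_of_seen_eq hs] at h1
      have : (s.decline J).plan.load s.seen.length = 0 := h.load_new
      linarith
  · rintro ⟨hj, h1⟩
    rw [job_of_seen_eq hs hj]
    exact ⟨Or.inl hj, h1⟩

theorem Sound.completing_append {s : DSCState} (h : s.Sound) (J : Job) (e : ℝ) :
    (s.append J e).completing = insert s.seen.length s.completing := by
  have hs : (s.append J e).seen = s.seen ++ [J] := rfl
  ext j
  rw [Finset.mem_insert, mem_completing, mem_completing, length_of_seen_eq hs,
    Nat.lt_succ_iff_lt_or_eq]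
  constructor
  · rintro ⟨hj | rfl, h1⟩
    · rw [job_of_seen_eq hs hj, load_append_plan J e hj] at h1
      exact Or.inr ⟨hj, h1⟩
    · exact Or.inl rfl
  · rintro (rfl | ⟨hj, h1⟩)
    · rw [job_length_of_seen_eq hs, h.load_append_new]
      exact ⟨Or.inr rfl, le_rfl⟩
    · rw [job_of_seen_eq hs hj, load_append_plan J e hj]
      exact ⟨Or.inl hj, h1⟩

theorem Sound.completing_accept {s : DSCState} (h : s.Sound) (J : Job) :
    (s.accept J).completing = insert s.seen.length (s.completing \ s.lost J) := by
  have hs : (s.accept J).seen = s.seen ++ [J] := rfl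
  ext j
  rw [Finset.mem_insert, Finset.mem_sdiff, mem_completing, mem_completing, length_of_seen_eq hs,
    Nat.lt_succ_iff_lt_or_eq]
  have hp : (s.accept J).plan = s.contend J := rfl
  constructor
  · rintro ⟨hj | rfl, h1⟩
    · rw [job_of_seen_eq hs hj, hp] at h1
      refine Or.inr ⟨⟨hj, h1.trans (h.load_contend_le hj)⟩, fun hl => ?_⟩
      have := h.load_contend_lt hl
      have := h.load_le j hj
      linarith
    · exact Or.inl rfl
  · rintro (rfl | ⟨⟨hj, h1⟩, h2⟩)
    · rw [job_length_of_seen_eq hs, hp, h.load_contend_new]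
      exact ⟨Or.inr rfl, le_rfl⟩
    · rw [job_of_seen_eq hs hj, hp, h.load_contend_eq hj h2]
      exact ⟨Or.inl hj, h1⟩

end DSCState

/-! ### The charging argument -/

namespace DSCState

/-- The net value of job `j`: its value less the penalty attributed to its acceptance. -/
noncomputable def net (s : DSCState) (j : ℕ) : ℝ := (s.job j).proc - s.charge j

/-- The processing planned for the jobs that are charged to `j` by the assignment `owner`. -/
noncomputable def groupLoad (s : DSCState) (owner : ℕ → ℕ) (j : ℕ) : ℝ :=
  ∑ i ∈ Finset.range s.seen.length, if owner i = j then s.plan.load i else 0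

/-- The measure of time that job `j` can pay for: `3 + 2√2` times its net value, less its processing
time if it was appended, since its own processing is then counted on top of the covered time. -/
noncomputable def surplus (s : DSCState) (appended : Finset ℕ) (j : ℕ) : ℝ :=
  (3 + 2 * √2) * s.net j - if j ∈ appended then (s.job j).proc else 0

open Classical in
/-- The total processing that the accepted jobs are missing in the tentative schedule. -/
noncomputable def shortfall (s : DSCState) : ℝ :=
  ∑ i ∈ Finset.range s.seen.length,
    if s.admitted i then (s.job i).proc - s.plan.load i else 0

/-- The bookkeeping that proves DSC competitive, for a state in which all releases so far are at or
before time `t`.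

Each planned job is charged to its `owner`, a job that is anticipated to be completed: to itself if
it is anticipated to be completed, and otherwise to the job that ousted it or, if that one was ousted
in turn, to the owner of that one. The values of `owner` at jobs that are not planned do not matter.
The jobs in `appended` were accepted without displacing others. The windows of all jobs, except those
in `appended` that are anticipated to be completed, lie in `covered`, which stems from earlier busy
periods and has measure at most `bound`, and in `[start, reach]`, which belongs to the current busy
period `[start, endTime)`. Both are paid for by the surpluses of the jobs released before and since
`first`, the job that began the current busy period. -/
structure Certificate (s : DSCState) (t : ℝ) where
  owner : ℕ → ℕ
  appended : Finset ℕ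
  first : ℕ
  start : ℝ
  endTime : ℝ
  reach : ℝ
  past : Plan
  cur : Plan
  covered : Set ℝ
  bound : ℝ
  sound : s.Sound
  busy : BusyPeriod s.plan first start endTime past cur
  first_le : first ≤ s.seen.length
  start_le : start ≤ t
  seen_le : ∀ K ∈ s.seen, K.release ≤ t
  start_le_release : ∀ i < s.seen.length, first ≤ i → start ≤ (s.job i).release
  endTime_le_reach : endTime ≤ reach
  window : ∀ i < s.seen.length, ¬ (i ∈ s.completing ∧ i ∈ appended) →
    Set.Icc (s.job i).release (s.job i).deadline ⊆ covered ∪ Set.Icc start reach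
  bound_nonneg : 0 ≤ bound
  volume_covered : volume covered ≤ ENNReal.ofReal bound
  charge_nonneg : ∀ j ∈ s.completing, 0 ≤ s.charge j
  group_le : ∀ j ∈ s.completing, √2 * (s.groupLoad owner j - s.net j) ≤ s.net j
  appended_group : ∀ j ∈ s.completing, j ∈ appended →
    s.charge j = 0 ∧ s.groupLoad owner j ≤ (s.job j).proc
  tight : ∀ j ∈ s.completing, j ∉ appended →
    ∃ g ∈ s.plan, g.job = j ∧ g.right = (s.job j).deadline
  owner_self : ∀ j ∈ s.completing, owner j = j
  owner_mem : ∀ g ∈ s.plan, owner g.job ∈ s.completing ∧ (first ≤ g.job → first ≤ owner g.job)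
  owner_tight : ∀ g ∈ s.plan, g.job ∉ s.completing →
    owner g.job ∉ appended ∧ g.right ≤ (s.job (owner g.job)).deadline
  past_le : bound ≤ ∑ j ∈ s.completing.filter (· < first), s.surplus appended j
  cur_le : reach - start ≤ ∑ j ∈ s.completing.filter (first ≤ ·), s.surplus appended j
  shortfall_le : s.shortfall ≤ ∑ j ∈ s.completing, s.charge j

theorem one_le_sqrt_two : (1 : ℝ) ≤ √2 := Real.one_le_sqrt.2 (by norm_num)

theorem sqrt_two_mul_self : √2 * √2 = (2 : ℝ) := Real.mul_self_sqrt (by norm_num)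

namespace Certificate

variable {s : DSCState} {t : ℝ}

theorem proc_le_groupLoad (c : Certificate s t) {j : ℕ} (hj : j ∈ s.completing) :
    (s.job j).proc ≤ s.groupLoad c.owner j := by
  rw [← c.sound.load_of_mem_completing hj, groupLoad]
  have hlt := Finset.mem_range.2 (mem_completing.1 hj).1
  refine le_trans ?_ (Finset.single_le_sum (f := fun i =>
    if c.owner i = j then s.plan.load i else 0) (fun i _ => ?_) hlt)
  · simp [c.owner_self j hj]
  · split_ifs
    exacts [Plan.load_nonneg c.sound.proper i, le_rfl]

theorem net_nonneg (c : Certificate s t) {j : ℕ} (hj : j ∈ s.completing) : 0 ≤ s.net j := by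
  have h1 := c.group_le j hj
  have h2 := c.proc_le_groupLoad hj
  have h3 := c.charge_nonneg j hj
  have h4 : 0 ≤ √2 * (s.groupLoad c.owner j - s.net j) := by
    refine mul_nonneg (Real.sqrt_nonneg _) ?_
    unfold net
    linarith
  linarith

theorem groupLoad_add_charge_le (c : Certificate s t) {j : ℕ} (hj : j ∈ s.completing) :
    s.groupLoad c.owner j + s.charge j ≤ (1 + √2) * s.net j := by
  have h1 := c.group_le j hj
  have h2 := c.proc_le_groupLoad hj
  have h3 : s.net j = (s.job j).proc - s.charge j := rfl
  have h4 := mul_le_mul_of_nonneg_left h1 (Real.sqrt_nonneg 2)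
  rw [← mul_assoc, sqrt_two_mul_self] at h4
  linarith

theorem le_surplus (c : Certificate s t) {j : ℕ} (hj : j ∈ s.completing) :
    s.groupLoad c.owner j + (s.charge j + (2 + √2) * s.net j) ≤ s.surplus c.appended j := by
  have h1 := c.groupLoad_add_charge_le hj
  have h3 : s.net j = (s.job j).proc - s.charge j := rfl
  unfold surplus
  split_ifs with ha
  · obtain ⟨h4, h5⟩ := c.appended_group j hj ha
    have := mul_le_mul_of_nonneg_right one_le_sqrt_two (c.net_nonneg hj)
    linarith
  · linarith

theorem groupLoad_le_surplus (c : Certificate s t) {j : ℕ} (hj : j ∈ s.completing) :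
    s.groupLoad c.owner j ≤ s.surplus c.appended j := by
  have h1 := c.le_surplus hj
  have h2 := c.charge_nonneg j hj
  have h3 : 0 ≤ (2 + √2) * s.net j := mul_nonneg (by positivity) (c.net_nonneg hj)
  linarith

theorem length_le (c : Certificate s t) :
    c.endTime - c.start ≤ ∑ j ∈ s.completing.filter (c.first ≤ ·), s.groupLoad c.owner j := by
  rw [c.busy.length_eq c.sound.job_lt]
  simp only [groupLoad]
  rw [Finset.sum_comm, Finset.sum_filter]
  refine Finset.sum_le_sum fun i _ => ?_
  rw [Finset.sum_ite_eq]
  have h0 := Plan.load_nonneg c.sound.proper i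
  split_ifs with h1 h2 h2
  · exact le_rfl
  · rcases h0.lt_or_eq with hp | hp
    · obtain ⟨g, hg, rfl⟩ := Plan.exists_mem_of_load_pos hp
      obtain ⟨h3, h4⟩ := c.owner_mem g hg
      exact absurd (Finset.mem_filter.2 ⟨h3, h4 h1⟩) h2
    · exact hp.ge
  · exact h0
  · exact le_rfl

/-- The certificate remains one as time goes by. -/
def mono (c : Certificate s t) {t' : ℝ} (h : t ≤ t') : Certificate s t' :=
  { c with
    start_le := c.start_le.trans h
    seen_le := fun K hK => (c.seen_le K hK).trans h }

theorem start_le_reach (c : Certificate s t) : c.start ≤ c.reach :=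
  c.busy.tiles.le.trans c.endTime_le_reach

/-- Once the tentative schedule has ended, a new busy period may begin. -/
def newPeriod (c : Certificate s t) (h : c.endTime ≤ t) : Certificate s t :=
  { c with
    first := s.seen.length
    start := t
    endTime := t
    reach := t
    past := s.plan
    cur := []
    covered := c.covered ∪ Set.Icc c.start c.reach
    bound := c.bound + (c.reach - c.start)
    busy :=
      { eq_append := by simp
        ordered := c.busy.pairwise
        past_right := fun g hg => (c.busy.right_le g hg).trans h
        past_job := c.sound.job_lt
        tiles := rfl
        cur_job := by simp }
    first_le := le_rfl
    start_le := le_rfl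
    start_le_release := fun i h1 h2 => absurd h1 h2.not_gt
    endTime_le_reach := le_rfl
    window := fun i hi h => (c.window i hi h).trans Set.subset_union_left
    bound_nonneg := add_nonneg c.bound_nonneg (sub_nonneg.2 c.start_le_reach)
    volume_covered := by
      refine (measure_union_le _ _).trans ?_
      rw [ENNReal.ofReal_add c.bound_nonneg (sub_nonneg.2 c.start_le_reach), Real.volume_Icc]
      gcongr
      exact c.volume_covered
    owner_mem := fun g hg =>
      ⟨(c.owner_mem g hg).1, fun h => absurd (c.sound.job_lt g hg) h.not_gt⟩
    past_le := by
      have h1 : s.completing.filter (· < s.seen.length) = s.completing :=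
        Finset.filter_true_of_mem fun j hj => (mem_completing.1 hj).1
      rw [h1, ← Finset.sum_filter_add_sum_filter_not s.completing (· < c.first)]
      simp only [not_lt]
      exact add_le_add c.past_le c.cur_le
    cur_le := by
      rw [Finset.filter_false_of_mem fun j hj => not_le.2 (mem_completing.1 hj).1]
      simp }

theorem total_le (c : Certificate s t) :
    c.bound + (c.reach - c.start) ≤ ∑ j ∈ s.completing, s.surplus c.appended j := by
  rw [← Finset.sum_filter_add_sum_filter_not s.completing (· < c.first)]
  simp only [not_lt]
  exact add_le_add c.past_le c.cur_le

theorem surplus_congr {s s' : DSCState} {a a' : Finset ℕ} {j : ℕ} (h1 : s'.job j = s.job j)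
    (h2 : s'.charge j = s.charge j) (h3 : j ∈ a' ↔ j ∈ a) : s'.surplus a' j = s.surplus a j := by
  simp [surplus, net, h1, h2, h3]

theorem net_congr {s s' : DSCState} {j : ℕ} (h1 : s'.job j = s.job j)
    (h2 : s'.charge j = s.charge j) : s'.net j = s.net j := by
  simp [net, h1, h2]

theorem nonempty_decline (c : Certificate s t) {J : Job} (hJ : 0 < J.proc)
    (hJt : J.release = t) (hw : J.release + J.proc ≤ J.deadline)
    (hend : J.deadline < c.endTime + J.proc)
    (hdec : s.profitAccept J ≤ (1 + (1 + √2)) * s.profitDecline J) :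
    Nonempty (Certificate (s.decline J) t) := by
  have h := c.sound
  have hs : (s.decline J).seen = s.seen ++ [J] := rfl
  have hl := length_of_seen_eq hs
  have hR := h.completing_decline hJ
  have hjob : ∀ j ∈ s.completing, (s.decline J).job j = s.job j :=
    fun j hj => job_of_seen_eq hs (mem_completing.1 hj).1
  have hnet : ∀ j ∈ s.completing, (s.decline J).net j = s.net j :=
    fun j hj => net_congr (hjob j hj) rfl
  have hsur : ∀ j ∈ s.completing,
      (s.decline J).surplus c.appended j = s.surplus c.appended j :=
    fun j hj => surplus_congr (hjob j hj) rfl Iff.rfl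
  have hgroup : ∀ j, (s.decline J).groupLoad c.owner j = s.groupLoad c.owner j := by
    intro j
    have : (s.decline J).plan.load s.seen.length = 0 := h.load_new
    rw [groupLoad, hl, Finset.sum_range_succ, this]
    simp [groupLoad, DSCState.decline]
  have hst : c.start ≤ J.deadline - J.proc := by linarith [c.start_le]
  -- The part of the window of `J` beyond the busy period is paid for by the ousted jobs.
  have hcur : J.deadline - c.start ≤
      ∑ j ∈ s.completing.filter (c.first ≤ ·), s.surplus c.appended j := by
    have h1 := h.sum_lost_le (J := J) c.busy hst (by linarith)
    rw [profitAccept, Job.value, h.penaltyAccept_eq hJ, h.profitDecline_eq hJ] at hdec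
    have h2 : ∑ j ∈ s.lost J ∩ s.completing, (s.charge j + (2 + √2) * s.net j) ≤
        ∑ j ∈ s.completing.filter (c.first ≤ ·), (s.charge j + (2 + √2) * s.net j) := by
      refine Finset.sum_le_sum_of_subset_of_nonneg ?_ fun j hj _ => ?_
      · intro j hj
        obtain ⟨hj1, hj2⟩ := Finset.mem_inter.1 hj
        obtain ⟨g, hg, rfl, hgw⟩ := Sound.exists_of_load_after_pos (mem_lost.1 hj1).2.1
        exact Finset.mem_filter.2 ⟨hj2, c.busy.first_le hg (hst.trans_lt hgw)⟩
      · have hj := (Finset.mem_filter.1 hj).1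
        exact add_nonneg (c.charge_nonneg j hj) (mul_nonneg (by positivity) (c.net_nonneg hj))
    have h3 : ∑ j ∈ s.completing.filter (c.first ≤ ·),
        (s.groupLoad c.owner j + (s.charge j + (2 + √2) * s.net j)) ≤
        ∑ j ∈ s.completing.filter (c.first ≤ ·), s.surplus c.appended j :=
      Finset.sum_le_sum fun j hj => c.le_surplus (Finset.mem_filter.1 hj).1
    have h4 := c.length_le
    rw [Finset.sum_add_distrib] at h3
    have h5 : ∑ j ∈ s.lost J ∩ s.completing, (s.charge j + (2 + √2) * s.net j) =
        ∑ j ∈ s.lost J ∩ s.completing, s.charge j +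
          (2 + √2) * ∑ j ∈ s.lost J ∩ s.completing, ((s.job j).proc - s.charge j) := by
      rw [Finset.sum_add_distrib, Finset.mul_sum]
      rfl
    linarith
  refine ⟨{ c with
    reach := max c.reach J.deadline
    sound := h.decline hJ
    busy := c.busy
    first_le := c.first_le.trans (by omega)
    seen_le := ?_
    start_le_release := ?_
    endTime_le_reach := c.endTime_le_reach.trans (le_max_left _ _)
    window := ?_
    charge_nonneg := by rw [hR]; exact c.charge_nonneg
    group_le := ?_
    appended_group := ?_
    tight := ?_
    owner_self := by rw [hR]; exact c.owner_self
    owner_mem := by rw [hR]; exact c.owner_mem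
    owner_tight := ?_
    past_le := ?_
    cur_le := ?_
    shortfall_le := ?_ }⟩
  · intro K hK
    rw [hs, List.mem_append, List.mem_singleton] at hK
    rcases hK with hK | rfl
    exacts [c.seen_le K hK, hJt.le]
  · intro i hi hfi
    rcases Nat.lt_succ_iff_lt_or_eq.1 (hl ▸ hi) with hi | rfl
    · rw [job_of_seen_eq hs hi]
      exact c.start_le_release i hi hfi
    · rw [job_length_of_seen_eq hs, hJt]
      exact c.start_le
  · intro i hi hni
    rcases Nat.lt_succ_iff_lt_or_eq.1 (hl ▸ hi) with hi | rfl
    · rw [job_of_seen_eq hs hi]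
      rw [hR] at hni
      exact (c.window i hi hni).trans
        (Set.union_subset_union_right _ (Set.Icc_subset_Icc_right (le_max_left _ _)))
    · rw [job_length_of_seen_eq hs]
      exact (Set.Icc_subset_Icc (hJt ▸ c.start_le) (le_max_right _ _)).trans
        Set.subset_union_right
  · rw [hR]
    intro j hj
    rw [hgroup, hnet j hj]
    exact c.group_le j hj
  · rw [hR]
    intro j hj
    rw [hgroup, hjob j hj]
    exact c.appended_group j hj
  · rw [hR]
    intro j hj
    rw [hjob j hj]
    exact c.tight j hj
  · rw [hR]
    intro g hg
    rw [hjob _ (c.owner_mem g hg).1]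
    exact c.owner_tight g hg
  · rw [hR]
    refine c.past_le.trans_eq (Finset.sum_congr rfl fun j hj => ?_)
    exact (hsur j (Finset.mem_filter.1 hj).1).symm
  · rw [hR]
    have : ∑ j ∈ s.completing.filter (c.first ≤ ·), (s.decline J).surplus c.appended j =
        ∑ j ∈ s.completing.filter (c.first ≤ ·), s.surplus c.appended j :=
      Finset.sum_congr rfl fun j hj => hsur j (Finset.mem_filter.1 hj).1
    rw [this, sub_le_iff_le_add]
    exact max_le (by linarith [c.cur_le]) (by linarith)
  · rw [hR, shortfall, hl, Finset.sum_range_succ]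
    have hn : ¬ (s.decline J).admitted s.seen.length := fun hn => (h.admitted_lt _ hn).false
    rw [if_neg hn, add_zero]
    refine le_trans (Finset.sum_le_sum fun i hi => ?_) c.shortfall_le
    rw [job_of_seen_eq hs (Finset.mem_range.1 hi)]
    rfl

theorem nonempty_append (c : Certificate s t) {J : Job} (hJ : 0 < J.proc)
    (hJt : J.release = t) (hend : t ≤ c.endTime) (hd : c.endTime + J.proc ≤ J.deadline) :
    Nonempty (Certificate (s.append J c.endTime) t) := by
  have h := c.sound
  have hs : (s.append J c.endTime).seen = s.seen ++ [J] := rfl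
  have hl := length_of_seen_eq hs
  have hR := h.completing_append J c.endTime
  have hnR : s.seen.length ∉ s.completing := fun hn => (mem_completing.1 hn).1.false
  have hne : ∀ j ∈ s.completing, j ≠ s.seen.length := fun j hj he => hnR (he ▸ hj)
  have hjob : ∀ j ∈ s.completing, (s.append J c.endTime).job j = s.job j :=
    fun j hj => job_of_seen_eq hs (mem_completing.1 hj).1
  have hjobn := job_length_of_seen_eq hs
  have hcharge : ∀ j ∈ s.completing, (s.append J c.endTime).charge j = s.charge j :=
    fun j hj => Function.update_of_ne (hne j hj) _ _
  have hchargen : (s.append J c.endTime).charge s.seen.length = 0 := Function.update_self _ _ _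
  have hnet : ∀ j ∈ s.completing, (s.append J c.endTime).net j = s.net j :=
    fun j hj => net_congr (hjob j hj) (hcharge j hj)
  have hnetn : (s.append J c.endTime).net s.seen.length = J.proc := by
    rw [net, hjobn, hchargen, sub_zero]
  set owner := Function.update c.owner s.seen.length s.seen.length with howner
  set app := insert s.seen.length c.appended with happ
  have happ' : ∀ j ∈ s.completing, j ∈ app ↔ j ∈ c.appended := fun j hj => by
    simp [happ, hne j hj]
  have howner' : ∀ i < s.seen.length, owner i = c.owner i :=
    fun i hi => Function.update_of_ne hi.ne _ _
  have hownern : owner s.seen.length = s.seen.length := Function.update_self _ _ _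
  have hsur : ∀ j ∈ s.completing,
      (s.append J c.endTime).surplus app j = s.surplus c.appended j :=
    fun j hj => surplus_congr (hjob j hj) (hcharge j hj) (happ' j hj)
  have hsurn : (s.append J c.endTime).surplus app s.seen.length = (2 + 2 * √2) * J.proc := by
    rw [surplus, hnetn, hjobn, if_pos (Finset.mem_insert_self _ _)]
    ring
  have hgroup : ∀ j ∈ s.completing,
      (s.append J c.endTime).groupLoad owner j = s.groupLoad c.owner j := by
    intro j hj
    rw [groupLoad, hl, Finset.sum_range_succ, hownern, if_neg (hne j hj).symm, add_zero]
    refine Finset.sum_congr rfl fun i hi => ?_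
    rw [howner' i (Finset.mem_range.1 hi), load_append_plan J _ (Finset.mem_range.1 hi)]
  have hgroupn : (s.append J c.endTime).groupLoad owner s.seen.length = J.proc := by
    rw [groupLoad, hl, Finset.sum_range_succ, hownern, if_pos rfl, h.load_append_new,
      Finset.sum_eq_zero, zero_add]
    intro i hi
    have hi' := Finset.mem_range.1 hi
    rw [howner' i hi', load_append_plan J _ hi']
    split_ifs with ho
    · apply Plan.load_eq_zero
      rintro g hg rfl
      exact hne _ (c.owner_mem g hg).1 ho
    · rfl
  have hmem : ∀ g ∈ (s.append J c.endTime).plan,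
      g ∈ s.plan ∨ g = ⟨s.seen.length, c.endTime, c.endTime + J.proc⟩ := fun g hg => by
    simpa [DSCState.append] using hg
  have hsub : ∀ g ∈ s.plan, g ∈ (s.append J c.endTime).plan := fun g hg =>
    List.mem_append_left _ hg
  refine ⟨{ c with
    owner := owner
    appended := app
    endTime := c.endTime + J.proc
    reach := c.reach + J.proc
    cur := c.cur ++ [⟨s.seen.length, c.endTime, c.endTime + J.proc⟩]
    sound := h.append hJ (hJt ▸ hend) hd
    busy := ?_
    first_le := c.first_le.trans (by omega)
    seen_le := ?_
    start_le_release := ?_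
    endTime_le_reach := by linarith [c.endTime_le_reach]
    window := ?_
    charge_nonneg := ?_
    group_le := ?_
    appended_group := ?_
    tight := ?_
    owner_self := ?_
    owner_mem := ?_
    owner_tight := ?_
    past_le := ?_
    cur_le := ?_
    shortfall_le := ?_ }⟩
  · refine ⟨?_, c.busy.ordered, c.busy.past_right, c.busy.past_job,
      c.busy.tiles.append ⟨rfl, by simpa using hJ, rfl⟩, ?_⟩
    · rw [← List.append_assoc, ← c.busy.eq_append]
      rfl
    · intro g hg
      rw [List.mem_append, List.mem_singleton] at hg
      rcases hg with hg | rfl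
      exacts [c.busy.cur_job g hg, c.first_le]
  · intro K hK
    rw [hs, List.mem_append, List.mem_singleton] at hK
    rcases hK with hK | rfl
    exacts [c.seen_le K hK, hJt.le]
  · intro i hi hfi
    rcases Nat.lt_succ_iff_lt_or_eq.1 (hl ▸ hi) with hi | rfl
    · rw [job_of_seen_eq hs hi]
      exact c.start_le_release i hi hfi
    · rw [hjobn, hJt]
      exact c.start_le
  · intro i hi hni
    rw [hR] at hni
    rcases Nat.lt_succ_iff_lt_or_eq.1 (hl ▸ hi) with hi | rfl
    · rw [job_of_seen_eq hs hi]
      refine (c.window i hi fun hi' => hni ⟨Finset.mem_insert_of_mem hi'.1,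
        Finset.mem_insert_of_mem hi'.2⟩).trans
        (Set.union_subset_union_right _ (Set.Icc_subset_Icc_right (by linarith)))
    · exact absurd ⟨Finset.mem_insert_self _ _, Finset.mem_insert_self _ _⟩ hni
  · rw [hR, Finset.forall_mem_insert]
    refine ⟨hchargen.ge, fun j hj => ?_⟩
    rw [hcharge j hj]
    exact c.charge_nonneg j hj
  · rw [hR, Finset.forall_mem_insert]
    refine ⟨?_, fun j hj => ?_⟩
    · rw [hgroupn, hnetn]
      simpa using hJ.le
    · rw [hgroup j hj, hnet j hj]
      exact c.group_le j hj
  · rw [hR, Finset.forall_mem_insert]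
    refine ⟨fun _ => ⟨hchargen, ?_⟩, fun j hj ha => ?_⟩
    · rw [hgroupn, hjobn]
    · rw [hgroup j hj, hjob j hj, hcharge j hj]
      exact c.appended_group j hj ((happ' j hj).1 ha)
  · rw [hR, Finset.forall_mem_insert]
    refine ⟨fun hn => absurd (Finset.mem_insert_self _ _) hn, fun j hj ha => ?_⟩
    obtain ⟨g, hg, h1, h2⟩ := c.tight j hj fun ha' => ha ((happ' j hj).2 ha')
    exact ⟨g, hsub g hg, h1, by rw [h2, hjob j hj]⟩
  · rw [hR, Finset.forall_mem_insert]
    refine ⟨hownern, fun j hj => ?_⟩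
    rw [howner' j (mem_completing.1 hj).1]
    exact c.owner_self j hj
  · intro g hg
    rw [hR]
    rcases hmem g hg with hg | rfl
    · rw [howner' _ (h.job_lt g hg)]
      exact ⟨Finset.mem_insert_of_mem (c.owner_mem g hg).1, (c.owner_mem g hg).2⟩
    · change owner s.seen.length ∈ _ ∧ (_ → _ ≤ owner s.seen.length)
      rw [hownern]
      exact ⟨Finset.mem_insert_self _ _, id⟩
  · intro g hg hgR
    rw [hR, Finset.mem_insert, not_or] at hgR
    rcases hmem g hg with hg | rfl
    · have ho := (c.owner_mem g hg).1
      rw [howner' _ (h.job_lt g hg), happ' _ ho, hjob _ ho]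
      exact c.owner_tight g hg hgR.2
    · exact absurd rfl hgR.1
  · rw [hR, Finset.filter_insert, if_neg (by simpa using c.first_le)]
    refine c.past_le.trans_eq (Finset.sum_congr rfl fun j hj => ?_)
    exact (hsur j (Finset.mem_filter.1 hj).1).symm
  · rw [hR, Finset.filter_insert, if_pos c.first_le, Finset.sum_insert (by simp [hnR]), hsurn]
    have : ∑ j ∈ s.completing.filter (c.first ≤ ·), (s.append J c.endTime).surplus app j =
        ∑ j ∈ s.completing.filter (c.first ≤ ·), s.surplus c.appended j :=
      Finset.sum_congr rfl fun j hj => hsur j (Finset.mem_filter.1 hj).1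
    rw [this]
    have h1 : 0 ≤ √2 * J.proc := by positivity
    linarith [c.cur_le]
  · rw [hR, shortfall, hl, Finset.sum_range_succ, Finset.sum_insert hnR, hchargen, zero_add,
      h.load_append_new, hjobn, sub_self, ite_self, add_zero,
      Finset.sum_congr rfl hcharge]
    refine le_trans ?_ c.shortfall_le
    rw [shortfall]
    refine Finset.sum_le_sum fun i hi => ?_
    have hi' := Finset.mem_range.1 hi
    rw [job_of_seen_eq hs hi', load_append_plan J _ hi']
    have : (s.append J c.endTime).admitted i ↔ s.admitted i := by
      simp [DSCState.append, hi'.ne]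
    by_cases ha : s.admitted i
    · rw [if_pos (this.2 ha), if_pos ha]
    · rw [if_neg fun ha' => ha (this.1 ha'), if_neg ha]

/-- A job that loses processing is charged to an ousted job. -/
theorem owner_of_mem_lost (c : Certificate s t) {J : Job} (hJ : 0 < J.proc)
    (hst : c.start ≤ J.deadline - J.proc) (hend : J.deadline - J.proc ≤ c.endTime) {j : ℕ}
    (hj : j ∈ s.lost J) : c.owner j ∈ s.lost J ∩ s.completing := by
  have h := c.sound
  by_cases hR : j ∈ s.completing
  · rw [c.owner_self j hR]
    exact Finset.mem_inter.2 ⟨hj, hR⟩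
  obtain ⟨g, hg, rfl, hw⟩ := Sound.exists_of_load_after_pos (mem_lost.1 hj).2.1
  have ho := (c.owner_mem g hg).1
  obtain ⟨h1, h2⟩ := c.owner_tight g hg hR
  obtain ⟨k, hk, h3, h4⟩ := c.tight _ ho h1
  have hkw : J.deadline - J.proc < k.right := by linarith
  refine Finset.mem_inter.2 ⟨mem_lost.2 ⟨(mem_completing.1 ho).1, ?_, ?_⟩, ho⟩
  · rw [← h3]
    exact h.load_after_pos hk hkw
  · rw [← h3]
    exact h.not_completes_moved_of_tight hJ c.busy hst hend hk hkw (by rw [h4, h3])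

theorem nonempty_accept (c : Certificate s t) {J : Job} (hJ : 0 < J.proc)
    (hJt : J.release = t) (hw : J.release + J.proc ≤ J.deadline)
    (hend : J.deadline < c.endTime + J.proc)
    (hacc : s.profitAccept J > (1 + (1 + √2)) * s.profitDecline J) :
    Nonempty (Certificate (s.accept J) t) := by
  classical
  have h := c.sound
  have hst : c.start ≤ J.deadline - J.proc := by linarith [c.start_le]
  have hws : J.deadline - J.proc ≤ c.endTime := by linarith
  have hlen := c.length_le
  have hs : (s.accept J).seen = s.seen ++ [J] := rfl
  have hp : (s.accept J).plan = s.contend J := rfl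
  have hl := length_of_seen_eq hs
  have hR := h.completing_accept J
  set n := s.seen.length with hn
  set D := s.lost J ∩ s.completing with hD
  have hDR : ∀ j ∈ D, j ∈ s.completing := fun j hj => (Finset.mem_inter.1 hj).2
  have hlt : ∀ j ∈ s.completing, j < n := fun j hj => (mem_completing.1 hj).1
  have hnR : n ∉ s.completing := fun hn => (hlt n hn).false
  have hne : ∀ j ∈ s.completing, j ≠ n := fun j hj => (hlt j hj).ne
  have hjob : ∀ j < n, (s.accept J).job j = s.job j := fun j hj => job_of_seen_eq hs hj
  have hjobn : (s.accept J).job n = J := job_length_of_seen_eq hs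
  have hcharge : ∀ j < n, (s.accept J).charge j = s.charge j :=
    fun j hj => Function.update_of_ne hj.ne _ _
  have hchargen : (s.accept J).charge n = s.penaltyAccept J := Function.update_self _ _ _
  have hnet : ∀ j < n, (s.accept J).net j = s.net j :=
    fun j hj => net_congr (hjob j hj) (hcharge j hj)
  have hnetn : (s.accept J).net n = J.proc - s.penaltyAccept J := by
    rw [net, hjobn, hchargen]
  set owner : ℕ → ℕ := fun i => if i = n ∨ c.owner i ∈ D then n else c.owner i with howner
  have hownern : owner n = n := by simp [howner]
  set app := c.appended.erase n with happ
  have happn : n ∉ app := Finset.notMem_erase _ _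
  have happ' : ∀ j < n, (j ∈ app ↔ j ∈ c.appended) := fun j hj => by
    simp [happ, hj.ne]
  have hsur : ∀ j < n, (s.accept J).surplus app j = s.surplus c.appended j :=
    fun j hj => surplus_congr (hjob j hj) (hcharge j hj) (happ' j hj)
  have hsurn : (s.accept J).surplus app n = (3 + 2 * √2) * (s.accept J).net n := by
    rw [surplus, if_neg happn, sub_zero]
  have hload0 : ∀ i, 0 ≤ s.plan.load i := Plan.load_nonneg h.proper
  have hload0' : ∀ i, 0 ≤ (s.contend J).load i := Plan.load_nonneg (h.contend_proper hJ)
  have hX : ∀ j ∈ s.lost J, c.owner j ∈ D := fun j hj => c.owner_of_mem_lost hJ hst hws hj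
  -- The ousted jobs together with what is charged to them.
  set M := ∑ j ∈ D, (s.groupLoad c.owner j + s.charge j) with hM
  have hMb : √2 * M ≤ (2 + √2) * s.profitDecline J := by
    rw [h.profitDecline_eq hJ, hM, Finset.mul_sum, Finset.mul_sum]
    refine Finset.sum_le_sum fun j hj => ?_
    have h1 := mul_le_mul_of_nonneg_left (c.groupLoad_add_charge_le (hDR j hj))
      (Real.sqrt_nonneg 2)
    have h2 : √2 * ((1 + √2) * s.net j) = (2 + √2) * s.net j := by
      linear_combination s.net j * sqrt_two_mul_self
    exact h1.trans_eq h2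
  have hdec0 : 0 ≤ s.profitDecline J := by
    rw [h.profitDecline_eq hJ]
    exact Finset.sum_nonneg fun j hj => c.net_nonneg (hDR j hj)
  have hnetM : √2 * M ≤ (s.accept J).net n := by
    rw [hnetn]
    rw [profitAccept, Job.value] at hacc
    linarith
  have hnet0 : 0 ≤ (s.accept J).net n := by
    rw [hnetn]
    rw [profitAccept, Job.value] at hacc
    have : 0 ≤ (1 + (1 + √2)) * s.profitDecline J := mul_nonneg (by positivity) hdec0
    linarith
  have hGD : ∑ j ∈ D, s.groupLoad c.owner j =
      ∑ i ∈ Finset.range n, if c.owner i ∈ D then s.plan.load i else 0 := by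
    simp only [groupLoad]
    rw [Finset.sum_comm]
    exact Finset.sum_congr rfl fun i _ => by rw [Finset.sum_ite_eq]
  have hpen := h.penaltyAccept_eq hJ
  have hcD : 0 ≤ ∑ j ∈ D, s.charge j := Finset.sum_nonneg fun j hj => c.charge_nonneg j (hDR j hj)
  have hlostsum : ∑ j ∈ s.lost J, (s.plan.load j - (s.contend J).load j) =
      ∑ i ∈ Finset.range n, if i ∈ s.lost J then s.plan.load i - (s.contend J).load i else 0 := by
    rw [← Finset.sum_filter]
    refine Finset.sum_congr ?_ fun _ _ => rfl
    ext i
    simp only [Finset.mem_filter, Finset.mem_range]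
    exact ⟨fun hi => ⟨(mem_lost.1 hi).1, hi⟩, And.right⟩
  have hpen0 : 0 ≤ s.penaltyAccept J := by
    rw [hpen]
    refine add_nonneg (Finset.sum_nonneg fun j hj => ?_) hcD
    linarith [h.load_contend_lt hj]
  have hMdef : M = ∑ j ∈ D, s.groupLoad c.owner j + ∑ j ∈ D, s.charge j := by
    rw [hM, Finset.sum_add_distrib]
  have hgroup : ∀ j ∈ s.completing, (s.accept J).groupLoad owner j ≤ s.groupLoad c.owner j := by
    intro j hj
    rw [groupLoad, hl, Finset.sum_range_succ, hownern, if_neg (hne j hj).symm, add_zero]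
    refine Finset.sum_le_sum fun i hi => ?_
    have hi' := Finset.mem_range.1 hi
    simp only [howner, hi'.ne, false_or, hp]
    by_cases ho : c.owner i ∈ D
    · rw [if_pos ho, if_neg (hne j hj).symm]
      split_ifs
      exacts [hload0 i, le_rfl]
    · rw [if_neg ho]
      split_ifs
      exacts [h.load_contend_le hi', le_rfl]
  -- What `J` displaces passes to `J`, either as processing charged to it or as penalty.
  have hgroupn : (s.accept J).groupLoad owner n - (s.accept J).net n ≤ M := by
    rw [groupLoad, hl, Finset.sum_range_succ, hownern, if_pos rfl, hp, h.load_contend_new, hnetn,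
      hpen, hlostsum, hMdef, hGD]
    have : ∑ i ∈ Finset.range n, (if owner i = n then (s.contend J).load i else 0) +
        ∑ i ∈ Finset.range n,
          (if i ∈ s.lost J then s.plan.load i - (s.contend J).load i else 0) ≤
        ∑ i ∈ Finset.range n, if c.owner i ∈ D then s.plan.load i else 0 := by
      rw [← Finset.sum_add_distrib]
      refine Finset.sum_le_sum fun i hi => ?_
      have hi' := Finset.mem_range.1 hi
      have hle := h.load_contend_le (J := J) hi'
      simp only [howner, hi'.ne, false_or]
      by_cases ho : c.owner i ∈ D
      · rw [if_pos ho, if_pos rfl, if_pos ho]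
        split_ifs <;> linarith
      · have hnl : i ∉ s.lost J := fun hi => ho (hX i hi)
        rw [if_neg ho, if_neg ho, if_neg hnl, add_zero]
        split_ifs with hon
        · rw [h.load_contend_eq hi' hnl]
          refine (Plan.load_eq_zero ?_).le
          rintro g hg rfl
          exact hne _ (c.owner_mem g hg).1 hon
        · exact le_rfl
    linarith
  have hpenM : s.penaltyAccept J ≤ M := by
    rw [hpen, hlostsum, hMdef, hGD]
    gcongr with i hi
    have hi' := Finset.mem_range.1 hi
    by_cases hil : i ∈ s.lost J
    · rw [if_pos hil, if_pos (hX i hil)]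
      linarith [hload0' i]
    · rw [if_neg hil]
      split_ifs
      exacts [hload0 i, le_rfl]
  have hGM : ∑ j ∈ D, s.groupLoad c.owner j ≤ M := by linarith
  have h2M : 2 * M ≤ √2 * (s.accept J).net n := by
    have := mul_le_mul_of_nonneg_left hnetM (Real.sqrt_nonneg 2)
    rwa [← mul_assoc, sqrt_two_mul_self] at this
  have hDfirst : ∀ j ∈ D, c.first ≤ j := by
    intro j hj
    obtain ⟨g, hg, rfl, hgw⟩ :=
      Sound.exists_of_load_after_pos (mem_lost.1 (Finset.mem_inter.1 hj).1).2.1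
    exact c.busy.first_le hg (hst.trans_lt hgw)
  have hsdiff : s.completing \ s.lost J = s.completing \ D := by
    ext j
    simp only [hD, Finset.mem_sdiff, Finset.mem_inter]
    tauto
  -- Where a piece of the new plan comes from.
  have hmem : ∀ g ∈ s.contend J, g.job = n ∨ g.job < n ∧ (∃ k ∈ s.plan, k.job = g.job) ∧
      (g.job ∉ s.completing \ s.lost J → g.right ≤ J.deadline - J.proc ∧
        ∃ k ∈ s.plan, k.job = g.job ∧ g.right ≤ k.right) := by
    intro g hg
    rcases h.mem_contend hg with hg | rfl | ⟨-, -, h1, ⟨k, hk, h2⟩, -⟩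
    · obtain ⟨k, hk, h1, -, -, h4⟩ := Plan.mem_before hg
      refine Or.inr ⟨h1 ▸ h.job_lt k hk, ⟨k, hk, h1.symm⟩, fun _ => ⟨?_, k, hk, h1.symm, ?_⟩⟩
      · rw [h4]; exact min_le_right _ _
      · rw [h4]; exact min_le_left _ _
    · exact Or.inl rfl
    · refine Or.inr ⟨h2 ▸ h.job_lt k hk, ⟨k, hk, h2⟩, fun hR => absurd ?_ hR⟩
      exact Finset.mem_sdiff.2 ⟨h.mem_completing_of_completes_moved hJ h1,
        fun hl => (mem_lost.1 hl).2.2 h1⟩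
  obtain ⟨e', cur', hbusy, he'⟩ := h.exists_busyPeriod_contend hJ c.busy hst hws c.first_le
  refine ⟨{ c with
    owner := owner
    appended := app
    endTime := e'
    reach := max c.reach (c.endTime + J.proc)
    cur := cur'
    sound := h.accept hJ hw (hJt ▸ c.seen_le)
    busy := hbusy
    first_le := c.first_le.trans (by omega)
    seen_le := ?_
    start_le_release := ?_
    endTime_le_reach := he'.trans (le_max_right _ _)
    window := ?_
    charge_nonneg := ?_
    group_le := ?_
    appended_group := ?_
    tight := ?_
    owner_self := ?_
    owner_mem := ?_
    owner_tight := ?_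
    past_le := ?_
    cur_le := ?_
    shortfall_le := ?_ }⟩
  · intro K hK
    rw [hs, List.mem_append, List.mem_singleton] at hK
    rcases hK with hK | rfl
    exacts [c.seen_le K hK, hJt.le]
  · intro i hi hfi
    rcases Nat.lt_succ_iff_lt_or_eq.1 (hl ▸ hi) with hi | rfl
    · rw [hjob i hi]
      exact c.start_le_release i hi hfi
    · rw [hjobn, hJt]
      exact c.start_le
  · intro i hi hni
    rw [hR] at hni
    rcases Nat.lt_succ_iff_lt_or_eq.1 (hl ▸ hi) with hi | rfl
    · rw [hjob i hi]
      rw [happ' i hi, Finset.mem_insert, or_iff_right hi.ne, Finset.mem_sdiff] at hni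
      by_cases hold : i ∈ s.completing ∧ i ∈ c.appended
      · have hil : i ∈ s.lost J := by
          by_contra hil
          exact hni ⟨⟨hold.1, hil⟩, hold.2⟩
        have h1 := h.deadline_lt_of_lost hJ c.busy hst hws hil hold.1
        have h2 := c.start_le_release i hi (hDfirst i (Finset.mem_inter.2 ⟨hil, hold.1⟩))
        exact (Set.Icc_subset_Icc h2 (h1.le.trans (le_max_right _ _))).trans
          Set.subset_union_right
      · exact (c.window i hi hold).trans
          (Set.union_subset_union_right _ (Set.Icc_subset_Icc_right (le_max_left _ _)))
    · rw [hjobn]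
      exact (Set.Icc_subset_Icc (hJt ▸ c.start_le) (hend.le.trans (le_max_right _ _))).trans
        Set.subset_union_right
  · rw [hR, Finset.forall_mem_insert]
    refine ⟨hchargen ▸ hpen0, fun j hj => ?_⟩
    have hj' := (Finset.mem_sdiff.1 hj).1
    rw [hcharge j (hlt j hj')]
    exact c.charge_nonneg j hj'
  · rw [hR, Finset.forall_mem_insert]
    refine ⟨?_, fun j hj => ?_⟩
    · exact (mul_le_mul_of_nonneg_left hgroupn (Real.sqrt_nonneg 2)).trans hnetM
    · have hj' := (Finset.mem_sdiff.1 hj).1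
      rw [hnet j (hlt j hj')]
      refine le_trans ?_ (c.group_le j hj')
      exact mul_le_mul_of_nonneg_left (sub_le_sub_right (hgroup j hj') _) (Real.sqrt_nonneg 2)
  · rw [hR, Finset.forall_mem_insert]
    refine ⟨fun ha => absurd ha happn, fun j hj ha => ?_⟩
    have hj' := (Finset.mem_sdiff.1 hj).1
    rw [hcharge j (hlt j hj'), hjob j (hlt j hj')]
    obtain ⟨h1, h2⟩ := c.appended_group j hj' ((happ' j (hlt j hj')).1 ha)
    exact ⟨h1, (hgroup j hj').trans h2⟩
  · rw [hR, Finset.forall_mem_insert]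
    refine ⟨fun _ => ⟨⟨n, J.deadline - J.proc, J.deadline⟩, ?_, rfl, by rw [hjobn]⟩,
      fun j hj ha => ?_⟩
    · rw [hp]
      simp [contend, ← hn]
    · obtain ⟨hj', hjl⟩ := Finset.mem_sdiff.1 hj
      obtain ⟨g, hg, h1, h2⟩ := c.tight j hj' fun ha' => ha ((happ' j (hlt j hj')).2 ha')
      refine ⟨g, ?_, h1, by rw [h2, hjob j (hlt j hj')]⟩
      have hgw : g.right ≤ J.deadline - J.proc := by
        by_contra! hgw
        refine hjl (mem_lost.2 ⟨hlt j hj', ?_, ?_⟩)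
        · rw [← h1]
          exact h.load_after_pos hg hgw
        · rw [← h1]
          exact h.not_completes_moved_of_tight hJ c.busy hst hws hg hgw (by rw [h2, h1])
      rw [hp]
      simp only [contend, List.append_assoc, List.mem_append]
      exact Or.inl (Plan.mem_before_of_right_le hg (h.proper g hg) hgw)
  · rw [hR, Finset.forall_mem_insert]
    refine ⟨hownern, fun j hj => ?_⟩
    obtain ⟨hj', hjl⟩ := Finset.mem_sdiff.1 hj
    have hjD : j ∉ D := fun hjD => hjl (Finset.mem_inter.1 hjD).1
    simp [howner, c.owner_self j hj', hne j hj', hjD]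
  · intro g hg
    rw [hR, hsdiff]
    rcases hmem g hg with h1 | ⟨h1, ⟨k, hk, h2⟩, -⟩
    · rw [h1, hownern]
      exact ⟨Finset.mem_insert_self _ _, id⟩
    · have ho := c.owner_mem k hk
      rw [h2] at ho
      by_cases hoD : c.owner g.job ∈ D
      · simp only [howner, hoD, or_true, if_true]
        exact ⟨Finset.mem_insert_self _ _, fun _ => c.first_le⟩
      · simp only [howner, hoD, h1.ne, or_false, if_false]
        exact ⟨Finset.mem_insert_of_mem (Finset.mem_sdiff.2 ⟨ho.1, hoD⟩), ho.2⟩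
  · intro g hg hgR
    rw [hR, Finset.mem_insert, not_or] at hgR
    rcases hmem g hg with h1 | ⟨h1, -, h3⟩
    · exact absurd h1 hgR.1
    obtain ⟨h4, k, hk, h5, h6⟩ := h3 hgR.2
    by_cases hoD : c.owner g.job ∈ D
    · simp only [howner, hoD, or_true, if_true, hjobn]
      exact ⟨happn, by linarith⟩
    · simp only [howner, hoD, h1.ne, or_false, if_false]
      have ho := (c.owner_mem k hk).1
      rw [h5] at ho
      have hnR : g.job ∉ s.completing := by
        intro hgc
        rw [c.owner_self _ hgc] at hoD
        exact hgR.2 (hsdiff ▸ Finset.mem_sdiff.2 ⟨hgc, hoD⟩)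
      have h7 := c.owner_tight k hk (h5 ▸ hnR)
      rw [h5] at h7
      rw [happ' _ (hlt _ ho), hjob _ (hlt _ ho)]
      exact ⟨h7.1, h6.trans h7.2⟩
  · rw [hR, Finset.filter_insert, if_neg (by simpa using c.first_le), hsdiff]
    refine c.past_le.trans_eq ?_
    have : (s.completing \ D).filter (· < c.first) = s.completing.filter (· < c.first) := by
      ext j
      simp only [Finset.mem_filter, Finset.mem_sdiff]
      refine ⟨fun hj => ⟨hj.1.1, hj.2⟩, fun hj => ⟨⟨hj.1, fun hjD => ?_⟩, hj.2⟩⟩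
      exact absurd (hDfirst j hjD) hj.2.not_ge
    rw [this]
    exact Finset.sum_congr rfl fun j hj => (hsur j (hlt j (Finset.mem_filter.1 hj).1)).symm
  · have hsplit : s.completing.filter (c.first ≤ ·) =
        (s.completing \ D).filter (c.first ≤ ·) ∪ D := by
      ext j
      simp only [Finset.mem_filter, Finset.mem_union, Finset.mem_sdiff]
      refine ⟨fun hj => ?_, ?_⟩
      · by_cases hjD : j ∈ D
        exacts [Or.inr hjD, Or.inl ⟨⟨hj.1, hjD⟩, hj.2⟩]
      · rintro (hj | hj)
        exacts [⟨hj.1.1, hj.2⟩, ⟨hDR j hj, hDfirst j hj⟩]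
    have hdisj : Disjoint ((s.completing \ D).filter (c.first ≤ ·)) D := by
      rw [Finset.disjoint_left]
      intro j hj hjD
      exact (Finset.mem_sdiff.1 (Finset.mem_filter.1 hj).1).2 hjD
    have hcur := c.cur_le
    rw [hsplit, Finset.sum_union hdisj] at hcur hlen
    have hsumD : ∑ j ∈ D, s.surplus c.appended j ≤ (3 + 2 * √2) * s.profitDecline J := by
      rw [h.profitDecline_eq hJ, Finset.mul_sum]
      refine Finset.sum_le_sum fun j hj => ?_
      have hpos := (h.proc_pos j (hlt j (hDR j hj))).le
      unfold surplus net
      split_ifs <;> linarith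
    have hGrest : ∑ j ∈ (s.completing \ D).filter (c.first ≤ ·), s.groupLoad c.owner j ≤
        ∑ j ∈ (s.completing \ D).filter (c.first ≤ ·), s.surplus c.appended j :=
      Finset.sum_le_sum fun j hj =>
        c.groupLoad_le_surplus (Finset.mem_sdiff.1 (Finset.mem_filter.1 hj).1).1
    rw [hR, hsdiff, Finset.filter_insert, if_pos c.first_le, Finset.sum_insert
      fun hnm => hnR (Finset.mem_sdiff.1 (Finset.mem_filter.1 hnm).1).1, hsurn]
    have hrest : ∑ j ∈ (s.completing \ D).filter (c.first ≤ ·), (s.accept J).surplus app j =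
        ∑ j ∈ (s.completing \ D).filter (c.first ≤ ·), s.surplus c.appended j :=
      Finset.sum_congr rfl fun j hj =>
        hsur j (hlt j (Finset.mem_sdiff.1 (Finset.mem_filter.1 hj).1).1)
    rw [hrest, sub_le_iff_le_add]
    have hge : s.profitDecline J ≤ (s.accept J).net n := by
      rw [hnetn]
      rw [profitAccept, Job.value] at hacc
      have : 0 ≤ √2 * s.profitDecline J := mul_nonneg (Real.sqrt_nonneg _) hdec0
      linarith
    have hge' := mul_le_mul_of_nonneg_left hge (show (0 : ℝ) ≤ 3 + 2 * √2 by positivity)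
    have hs0 : 0 ≤ √2 * (s.accept J).net n := mul_nonneg (Real.sqrt_nonneg _) hnet0
    refine max_le (by linarith) ?_
    have hproc : J.proc = (s.accept J).net n + s.penaltyAccept J := by rw [hnetn]; ring
    linarith
  · rw [hR, hsdiff, shortfall, hl, Finset.sum_range_succ, hp, h.load_contend_new, hjobn, sub_self,
      ite_self, add_zero, Finset.sum_insert fun hnm => hnR (Finset.mem_sdiff.1 hnm).1, hchargen,
      hpen, hlostsum]
    have h1 : ∑ j ∈ s.completing \ D, (s.accept J).charge j + ∑ j ∈ D, s.charge j =
        ∑ j ∈ s.completing, s.charge j := by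
      rw [← Finset.sum_sdiff (show D ⊆ s.completing from hDR)]
      congr 1
      exact Finset.sum_congr rfl fun j hj => hcharge j (hlt j (Finset.mem_sdiff.1 hj).1)
    have h2 : ∑ i ∈ Finset.range n, (if (s.accept J).admitted i then
          ((s.accept J).job i).proc - (s.contend J).load i else 0) ≤ s.shortfall +
        ∑ i ∈ Finset.range n,
          (if i ∈ s.lost J then s.plan.load i - (s.contend J).load i else 0) := by
      rw [shortfall, ← Finset.sum_add_distrib]
      refine Finset.sum_le_sum fun i hi => ?_
      have hi' := Finset.mem_range.1 hi
      have hadm : (s.accept J).admitted i ↔ s.admitted i := by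
        simp [DSCState.accept, ← hn, hi'.ne]
      rw [hjob i hi']
      simp only [hadm]
      by_cases hil : i ∈ s.lost J
      · have := h.load_contend_lt hil
        rw [if_pos hil]
        split_ifs <;> linarith
      · rw [if_neg hil, h.load_contend_eq hi' hil, add_zero]
    linarith [c.shortfall_le]

end Certificate

end DSCState

/-! ### The run of DSC on an instance -/

namespace DSCState

theorem seen_step (β : ℝ) (s : DSCState) (J : Job) : (step β s J).seen = s.seen ++ [J] := by
  rw [step_eq]
  split_ifs <;> rfl

theorem seen_foldl_step (β : ℝ) (l : List Job) (s : DSCState) :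
    (l.foldl (step β) s).seen = s.seen ++ l := by
  induction l generalizing s with
  | nil => simp
  | cons J l ih => rw [List.foldl_cons, ih, seen_step]; simp

theorem completing_init : init.completing = ∅ := by
  ext j
  simp [mem_completing, init]

/-- Before the first release there is nothing to account for. -/
def initCertificate : Certificate init 0 where
  owner := id
  appended := ∅
  first := 0
  start := 0
  endTime := 0
  reach := 0
  past := []
  cur := []
  covered := ∅
  bound := 0
  sound := by constructor <;> simp [init]
  busy := by constructor <;> simp [init, Plan.Tiles]
  first_le := le_rfl
  start_le := le_rfl
  seen_le := by simp [init]
  start_le_release := by simp [init]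
  endTime_le_reach := le_rfl
  window := by simp [init]
  bound_nonneg := le_rfl
  volume_covered := by simp
  charge_nonneg := by simp [completing_init]
  group_le := by simp [completing_init]
  appended_group := by simp
  tight := by simp [completing_init]
  owner_self := by simp [completing_init]
  owner_mem := by simp [init]
  owner_tight := by simp [init]
  past_le := by simp
  cur_le := by simp [completing_init]
  shortfall_le := by simp [shortfall, init]

/-- At each release the current busy period goes on or a new one begins, so that a job may be
appended exactly at the end of the busy period. -/
theorem Certificate.exists_endTime_ge {s : DSCState} {t r : ℝ} (c : Certificate s t) (h : t ≤ r) :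
    ∃ c' : Certificate s r, r ≤ c'.endTime ∧ s.plan.finish r = c'.endTime := by
  obtain ⟨c', hc'⟩ : ∃ c' : Certificate s r, r ≤ c'.endTime := by
    rcases le_total c.endTime r with hr | hr
    exacts [⟨(c.mono h).newPeriod hr, le_rfl⟩, ⟨c.mono h, hr⟩]
  refine ⟨c', hc', ?_⟩
  rw [c'.busy.eq_append, Plan.finish_eq c'.busy.past_right c'.busy.tiles c'.start_le,
    max_eq_right hc']

theorem Certificate.nonempty_step {s : DSCState} {t : ℝ} (c : Certificate s t) {J : Job}
    (hJ : 0 < J.proc) (hw : J.release + J.proc ≤ J.deadline) (h : t ≤ J.release) :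
    Nonempty (Certificate (step (1 + √2) s J) J.release) := by
  obtain ⟨c', hc', hf⟩ := c.exists_endTime_ge h
  rw [step_eq, hf]
  split_ifs with h1 h2
  · exact c'.nonempty_append hJ rfl hc' h1
  · exact c'.nonempty_accept hJ rfl hw (not_le.1 h1) h2
  · exact c'.nonempty_decline hJ rfl hw (not_le.1 h1) (not_lt.1 h2)

theorem Certificate.exists_foldl {l : List Job} {s : DSCState} {t : ℝ} (c : Certificate s t)
    (hl : l.Pairwise (fun J K => J.release ≤ K.release)) (ht : ∀ J ∈ l, t ≤ J.release)
    (hp : ∀ J ∈ l, 0 < J.proc) (hw : ∀ J ∈ l, J.release + J.proc ≤ J.deadline) :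
    ∃ t', Nonempty (Certificate (l.foldl (step (1 + √2)) s) t') ∧
      ∀ r, t ≤ r → (∀ J ∈ l, J.release ≤ r) → t' ≤ r := by
  induction l generalizing s t with
  | nil => exact ⟨t, ⟨c⟩, fun r hr _ => hr⟩
  | cons J l ih =>
    obtain ⟨h1, h2⟩ := List.pairwise_cons.1 hl
    obtain ⟨c'⟩ := c.nonempty_step (hp J (by simp)) (hw J (by simp)) (ht J (by simp))
    obtain ⟨t', hc, h3⟩ := ih c' h2 h1 (fun K hK => hp K (by simp [hK]))
      (fun K hK => hw K (by simp [hK]))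
    exact ⟨t', hc, fun r _ hr => h3 r (hr J (by simp)) fun K hK => hr K (by simp [hK])⟩

end DSCState

/-! ### DSC is online -/

namespace Plan

theorem run_append (P Q : Plan) (t : ℝ) : run (P ++ Q) t = (run P t).or (run Q t) := by
  unfold run
  rw [List.find?_append]
  cases P.find? _ <;> simp

theorem run_eq_none {P : Plan} {t : ℝ} (h : ∀ g ∈ P, t < g.left) : P.run t = none := by
  simp only [run, Option.map_eq_none_iff, List.find?_eq_none, decide_eq_true_eq, not_and]
  exact fun g hg hl => absurd hl (h g hg).not_ge

theorem run_cons (g : Piece) (P : Plan) (t : ℝ) :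
    run (g :: P) t = if g.left ≤ t ∧ t < g.right then some g.job else run P t := by
  by_cases h : g.left ≤ t ∧ t < g.right
  · simp [run, h]
  · unfold run
    rw [List.find?_cons_of_neg (by simpa using h), if_neg h]

theorem run_before {P : Plan} {t w : ℝ} (h : t < w) : (P.before w).run t = P.run t := by
  induction P with
  | nil => rfl
  | cons g P ih =>
    rw [before_cons, run_cons]
    by_cases hw : g.left < w
    · rw [if_pos hw, run_cons, ih]
      simp [h]
    · rw [if_neg hw, if_neg fun h' => hw (h'.1.trans_lt h), ih]

end Plan

namespace DSCState

theorem run_step {s : DSCState} {t : ℝ} (c : Certificate s t) {J : Job}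
    (hJ : 0 < J.proc) (hw : J.release + J.proc ≤ J.deadline) (h : t ≤ J.release) {x : ℝ}
    (hx : x < J.release) : (step (1 + √2) s J).plan.run x = s.plan.run x := by
  obtain ⟨c', hc', hf⟩ := c.exists_endTime_ge h
  rw [step_eq, hf]
  split_ifs with h1 h2
  · rw [append, Plan.run_append, Plan.run_eq_none (P := [_]), Option.or_none]
    simp only [List.mem_singleton, forall_eq]
    linarith
  · have hpr := Plan.after_proper c.sound.proper (J.deadline - J.proc)
    rw [accept, contend, List.append_assoc, Plan.run_append, Plan.run_before (by linarith),
      Plan.run_eq_none (P := [_] ++ _), Option.or_none]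
    intro g hg
    rcases List.mem_append.1 hg with hg | hg
    · rw [List.mem_singleton] at hg
      rw [hg]
      simp only
      linarith
    · have := ((Plan.tiles_layOut (fun k hk => hpr k (List.mem_of_mem_filter hk)) _).bounds g hg).1
      linarith
  · rfl

theorem admitted_step (β : ℝ) (s : DSCState) (J : Job) {i : ℕ} (hi : i < s.seen.length) :
    (step β s J).admitted i ↔ s.admitted i := by
  rw [step_eq]
  split_ifs <;> simp [append, accept, decline, hi.ne]

/-- Later releases change neither the decisions made so far nor the past use of the processor. -/
theorem foldl_step_eq {l : List Job} {s : DSCState} {t : ℝ} (c : Certificate s t)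
    (hl : l.Pairwise (fun J K => J.release ≤ K.release)) (ht : ∀ J ∈ l, t ≤ J.release)
    (hp : ∀ J ∈ l, 0 < J.proc) (hw : ∀ J ∈ l, J.release + J.proc ≤ J.deadline) :
    (∀ i < s.seen.length, (l.foldl (step (1 + √2)) s).admitted i ↔ s.admitted i) ∧
      ∀ x, (∀ J ∈ l, x < J.release) →
        (l.foldl (step (1 + √2)) s).plan.run x = s.plan.run x := by
  induction l generalizing s t with
  | nil => simp
  | cons J l ih =>
    obtain ⟨h1, h2⟩ := List.pairwise_cons.1 hl
    have hJ := hp J (by simp)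
    have hwJ := hw J (by simp)
    have htJ := ht J (by simp)
    obtain ⟨c'⟩ := c.nonempty_step hJ hwJ htJ
    obtain ⟨h3, h4⟩ := ih c' h2 h1 (fun K hK => hp K (by simp [hK]))
      (fun K hK => hw K (by simp [hK]))
    refine ⟨fun i hi => ?_, fun x hx => ?_⟩
    · rw [List.foldl_cons, h3 i (by rw [seen_step]; simp; omega), admitted_step _ _ _ hi]
    · rw [List.foldl_cons, h4 x fun K hK => hx K (by simp [hK]),
        run_step c hJ hwJ htJ (hx J (by simp))]

end DSCState

theorem JobInstance.exists_jobs_eq_released_append (I : JobInstance) (t : ℝ) :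
    ∃ l, I.jobs = I.released t ++ l ∧ ∀ J ∈ l, t < J.release := by
  classical
  have key : ∀ L : List Job, L.Pairwise (fun J K => J.release ≤ K.release) →
      ∃ l, L = L.filter (fun J => J.release ≤ t) ++ l ∧ ∀ J ∈ l, t < J.release := by
    intro L
    induction L with
    | nil => intro _; exact ⟨[], by simp⟩
    | cons J L ih =>
      intro hL
      obtain ⟨h1, h2⟩ := List.pairwise_cons.1 hL
      by_cases hJ : J.release ≤ t
      · obtain ⟨l, h3, h4⟩ := ih h2
        refine ⟨l, ?_, h4⟩
        rw [List.filter_cons_of_pos (by simpa using hJ), List.cons_append, ← h3]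
      · have h5 : ∀ K ∈ J :: L, t < K.release := by
          intro K hK
          rcases List.mem_cons.1 hK with rfl | hK
          exacts [not_le.1 hJ, (not_le.1 hJ).trans_le (h1 K hK)]
        refine ⟨J :: L, ?_, h5⟩
        have : (J :: L).filter (fun J => J.release ≤ t) = [] := by
          rw [List.filter_eq_nil_iff]
          intro K hK
          simpa using h5 K hK
        rw [this, List.nil_append]
  obtain ⟨l, h1, h2⟩ := key I.jobs I.sorted
  refine ⟨l, ?_, h2⟩
  unfold released
  convert h1

theorem isOnline_dsc : IsOnline (dsc (1 + √2)) := by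
  intro I I' t hII'
  have key : ∀ I : JobInstance,
      (∀ i < (I.released t).length, (dsc (1 + √2) I).admits i ↔
        ((I.released t).foldl (DSCState.step (1 + √2)) DSCState.init).admitted i) ∧
      ∀ x ≤ t, (dsc (1 + √2) I).run x =
        ((I.released t).foldl (DSCState.step (1 + √2)) DSCState.init).plan.run x := by
    intro I
    obtain ⟨l, hl, hlt⟩ := I.exists_jobs_eq_released_append t
    have hsorted := I.sorted
    rw [hl, List.pairwise_append] at hsorted
    obtain ⟨hs1, hs2, hs3⟩ := hsorted
    have hmem1 : ∀ J ∈ I.released t, J ∈ I.jobs := fun J hJ => by rw [hl]; simp [hJ]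
    have hmem2 : ∀ J ∈ l, J ∈ I.jobs := fun J hJ => by rw [hl]; simp [hJ]
    obtain ⟨t', ⟨c⟩, ht'⟩ := DSCState.initCertificate.exists_foldl hs1
      (fun J hJ => I.release_nonneg J (hmem1 J hJ)) (fun J hJ => I.proc_pos J (hmem1 J hJ))
      (fun J hJ => I.window J (hmem1 J hJ))
    obtain ⟨h1, h2⟩ := DSCState.foldl_step_eq c hs2
      (fun J hJ => ht' _ (I.release_nonneg J (hmem2 J hJ)) fun K hK => hs3 K hK J hJ)
      (fun J hJ => I.proc_pos J (hmem2 J hJ)) (fun J hJ => I.window J (hmem2 J hJ))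
    rw [← List.foldl_append, ← hl] at h1 h2
    refine ⟨fun i hi => h1 i ?_, fun x hx => h2 x fun J hJ => hx.trans_lt (hlt J hJ)⟩
    rw [DSCState.seen_foldl_step]
    simpa [DSCState.init] using hi
  obtain ⟨h1, h2⟩ := key I
  obtain ⟨h3, h4⟩ := key I'
  refine ⟨fun i hi => ?_, fun x hx => ?_⟩
  · rw [h1 i hi, h3 i (hII' ▸ hi), hII']
  · rw [h2 x hx, h4 x hx, hII']

/-! ### DSC is competitive -/

theorem Schedule.work_nonneg (S : Schedule) (J : Job) (i : ℕ) : 0 ≤ S.work J i :=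
  ENNReal.toReal_nonneg

/-- The jobs of a finite set whose windows lie in `E` receive in total no more processing than the
measure of `E`. -/
theorem Schedule.sum_work_le (S : Schedule) (T : Finset ℕ) (job : ℕ → Job) {E : Set ℝ} {x : ℝ}
    (hx : 0 ≤ x) (hE : volume E ≤ ENNReal.ofReal x)
    (hT : ∀ i ∈ T, Set.Icc (job i).release (job i).deadline ⊆ E) :
    ∑ i ∈ T, S.work (job i) i ≤ x := by
  unfold Schedule.work
  rw [← ENNReal.toReal_sum]
  · refine ENNReal.toReal_le_of_le_ofReal hx ?_
    rw [← measure_biUnion_finset]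
    · refine (measure_mono (Set.iUnion₂_subset fun i hi => ?_)).trans hE
      exact Set.inter_subset_right.trans (hT i hi)
    · intro i _ j _ hij
      refine Set.disjoint_left.2 fun t ht ht' => hij ?_
      have h1 : S.run t = some i := ht.1
      have h2 : S.run t = some j := ht'.1
      rw [h1] at h2
      exact Option.some.inj h2
    · exact fun i _ => (S.measurable_run i).inter measurableSet_Icc
  · intro i _
    exact ((measure_mono Set.inter_subset_right).trans_lt (by simp [Real.volume_Icc])).ne

theorem Schedule.jobProfit_le (S : Schedule) {J : Job} (hJ : 0 < J.proc) (i : ℕ) :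
    S.jobProfit J i ≤ J.proc := by
  have := S.work_nonneg J i
  unfold Schedule.jobProfit Job.value
  split_ifs <;> linarith

theorem Schedule.jobProfit_le_work (S : Schedule) (J : Job) (i : ℕ) :
    S.jobProfit J i ≤ S.work J i := by
  have := S.work_nonneg J i
  unfold Schedule.jobProfit Job.value
  split_ifs <;> linarith

namespace DSCState

theorem profit_eq_sum_range {I : JobInstance} {s : DSCState} (hs : s.seen = I.jobs)
    (S : Schedule) :
    profit I S = ∑ i ∈ Finset.range s.seen.length, S.jobProfit (s.job i) i := by
  obtain ⟨seen, plan, adm, charge⟩ := s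
  subst hs
  rw [← Fin.sum_univ_eq_sum_range (fun i => S.jobProfit _ i)]
  refine Finset.sum_congr rfl fun i _ => ?_
  rw [Fin.getElem_fin, getElem_seen (s := ⟨I.jobs, plan, adm, charge⟩) i.2]

/-- No schedule earns more than `3 + 2√2` times the net values of the jobs that DSC completes: the
appended jobs among them are counted in full, and all others within the covered time. -/
theorem Certificate.profit_le {I : JobInstance} {s : DSCState} {t : ℝ} (c : Certificate s t)
    (hs : s.seen = I.jobs) (S : Schedule) :
    profit I S ≤ (3 + 2 * √2) * ∑ j ∈ s.completing, s.net j := by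
  classical
  set C := s.completing.filter (· ∈ c.appended) with hC
  have hCsub : C ⊆ Finset.range s.seen.length := fun j hj =>
    Finset.mem_range.2 (mem_completing.1 (Finset.mem_filter.1 hj).1).1
  rw [profit_eq_sum_range hs, ← Finset.sum_sdiff hCsub]
  have h1 : ∑ i ∈ C, S.jobProfit (s.job i) i ≤ ∑ i ∈ C, (s.job i).proc :=
    Finset.sum_le_sum fun i hi => S.jobProfit_le
      (c.sound.proc_pos i (Finset.mem_range.1 (hCsub hi))) i
  have h2 : ∑ i ∈ Finset.range s.seen.length \ C, S.jobProfit (s.job i) i ≤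
      c.bound + (c.reach - c.start) := by
    refine (Finset.sum_le_sum fun i _ => S.jobProfit_le_work (s.job i) i).trans ?_
    have hr := sub_nonneg.2 c.start_le_reach
    refine S.sum_work_le _ s.job (E := c.covered ∪ Set.Icc c.start c.reach)
      (add_nonneg c.bound_nonneg hr) ?_ ?_
    · refine (measure_union_le _ _).trans ?_
      rw [ENNReal.ofReal_add c.bound_nonneg hr, Real.volume_Icc]
      gcongr
      exact c.volume_covered
    · intro i hi
      obtain ⟨hi1, hi2⟩ := Finset.mem_sdiff.1 hi
      exact c.window i (Finset.mem_range.1 hi1) fun h => hi2 (Finset.mem_filter.2 h)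
  have h3 : ∑ j ∈ s.completing, s.surplus c.appended j + ∑ i ∈ C, (s.job i).proc =
      (3 + 2 * √2) * ∑ j ∈ s.completing, s.net j := by
    rw [hC, Finset.sum_filter, ← Finset.sum_add_distrib, Finset.mul_sum]
    exact Finset.sum_congr rfl fun j _ => by rw [surplus]; ring
  linarith [c.total_le]

/-- Executing its tentative schedule, DSC earns the net values of the jobs it completes. -/
theorem Certificate.le_profit {I : JobInstance} {s : DSCState} {t : ℝ} (c : Certificate s t)
    (hs : s.seen = I.jobs) {S : Schedule} (hadm : S.admits = s.admitted)
    (hrun : S.run = s.plan.run) : ∑ j ∈ s.completing, s.net j ≤ profit I S := by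
  classical
  have h := c.sound
  have h1 : ∑ j ∈ s.completing, (s.job j).proc - s.shortfall ≤ profit I S := by
    rw [profit_eq_sum_range hs, shortfall, completing, Finset.sum_filter, ← Finset.sum_sub_distrib]
    refine Finset.sum_le_sum fun i hi => ?_
    have hi' := Finset.mem_range.1 hi
    have hp := h.proc_pos i hi'
    have hle := h.load_le i hi'
    have hwork : s.plan.load i ≤ S.work (s.job i) i := by
      unfold Schedule.work
      rw [hrun]
      apply Plan.load_le_volume_run c.busy.pairwise h.proper
      rintro g hg rfl
      exact ⟨h.release_le g hg, h.right_le g hg⟩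
    unfold Schedule.jobProfit Job.value
    rw [hadm]
    by_cases ha : s.admitted i
    · simp only [ha, if_true]
      split_ifs <;> linarith
    · have h0 : s.plan.load i = 0 := Plan.load_eq_zero fun g hg hgi =>
        ha (hgi ▸ h.admitted_of_mem g hg)
      rw [if_neg ha, if_neg ha, if_neg (by linarith)]
      simp
  have h2 : ∑ j ∈ s.completing, s.net j =
      ∑ j ∈ s.completing, (s.job j).proc - ∑ j ∈ s.completing, s.charge j := by
    rw [← Finset.sum_sub_distrib]
    rfl
  linarith [c.shortfall_le]

end DSCState

theorem isCompetitive_dsc : IsCompetitive (dsc (1 + √2)) (3 - 2 * √2) := by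
  intro I
  obtain ⟨t, ⟨c⟩, -⟩ := DSCState.initCertificate.exists_foldl I.sorted I.release_nonneg
    I.proc_pos I.window
  have hs := DSCState.seen_foldl_step (1 + √2) I.jobs DSCState.init
  rw [show DSCState.init.seen = [] from rfl, List.nil_append] at hs
  have h1 := c.le_profit hs (S := dsc (1 + √2) I) rfl rfl
  have h2 : optOffline I ≤ _ := ciSup_le fun S => c.profit_le hs S
  have h3 : (0 : ℝ) ≤ 3 - 2 * √2 := by
    have : √2 ≤ 3 / 2 := Real.sqrt_le_iff.2 (by norm_num)
    linarith
  refine (mul_le_mul_of_nonneg_left h2 h3).trans (le_of_eq_of_le ?_ h1)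
  have := DSCState.sqrt_two_mul_self
  rw [← mul_assoc]
  linear_combination (-4 * ∑ j ∈ (I.jobs.foldl (DSCState.step (1 + √2)) DSCState.init).completing,
    (I.jobs.foldl (DSCState.step (1 + √2)) DSCState.init).net j) * this

/-! ### The adversary -/

section Recursion

variable (acc : ℕ → Prop) (ρ : ℝ)

open Classical in
/-- The total size of the accepted jobs among the first `n`, when job `k` has size `ρ ^ k`. -/
noncomputable def acceptedSize (n : ℕ) : ℝ :=
  ∑ k ∈ Finset.range n, if acc k then ρ ^ k else 0

open Classical in
/-- The best that can be earned from the first `n` jobs if at most one can be completed and the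
accepted jobs before it are lost: the maximum of `0` and `ρ ^ k - acceptedSize k` over the accepted
jobs `k < n`. -/
noncomputable def bestProfit : ℕ → ℝ
  | 0 => 0
  | n + 1 => if acc n then max (bestProfit n) (ρ ^ n - acceptedSize acc ρ n) else bestProfit n

variable {acc ρ}

theorem le_bestProfit {k n : ℕ} (hk : acc k) (hkn : k < n) :
    ρ ^ k - acceptedSize acc ρ k ≤ bestProfit acc ρ n := by
  induction n with
  | zero => omega
  | succ n ih =>
    rw [bestProfit]
    rcases Nat.lt_succ_iff_lt_or_eq.1 hkn with h | rfl
    · split_ifs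
      exacts [(ih h).trans (le_max_left _ _), ih h]
    · rw [if_pos hk]
      exact le_max_right _ _

theorem bestProfit_nonneg (n : ℕ) : 0 ≤ bestProfit acc ρ n := by
  induction n with
  | zero => exact le_rfl
  | succ n ih =>
    rw [bestProfit]
    split_ifs
    exacts [ih.trans (le_max_left _ _), ih]

open Classical in
theorem acceptedSize_succ (n : ℕ) :
    acceptedSize acc ρ (n + 1) = acceptedSize acc ρ n + if acc n then ρ ^ n else 0 :=
  Finset.sum_range_succ _ _

/-- Either the best profit stays and the accepted size does not shrink, or the best profit rises and
is then attained by the last job. -/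
theorem bestProfit_succ_cases (hρ : 0 < ρ) (n : ℕ) :
    (bestProfit acc ρ (n + 1) = bestProfit acc ρ n ∧
        acceptedSize acc ρ n ≤ acceptedSize acc ρ (n + 1)) ∨
      (bestProfit acc ρ n < ρ ^ n - acceptedSize acc ρ n ∧
        bestProfit acc ρ (n + 1) = ρ ^ n - acceptedSize acc ρ n ∧
        acceptedSize acc ρ (n + 1) = acceptedSize acc ρ n + ρ ^ n) := by
  have hpos := pow_pos hρ n
  rw [acceptedSize_succ, bestProfit]
  split_ifs with ha
  · rcases le_or_gt (ρ ^ n - acceptedSize acc ρ n) (bestProfit acc ρ n) with h | h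
    · exact Or.inl ⟨max_eq_left h, by linarith⟩
    · exact Or.inr ⟨h, max_eq_right h.le, rfl⟩
  · exact Or.inl ⟨rfl, by linarith⟩

/-- If the best profit rises from `m` to `p - σ` by accepting a job of size `p ≤ c * m` when the
accepted size was `σ`, then the ratio of accepted size to best profit rises by `δ`. This is where
`c < 3 + 2√2` is used: it makes the discriminant of `v ^ 2 - (c - 1) * v + c` negative. -/
theorem ratio_rises {c δ m p σ v : ℝ} (hδ : 0 ≤ δ)
    (hδc : c * δ = c - (c - 1) ^ 2 / 4) (hm : 0 < m) (hv : 0 ≤ v) (hσ : v * m ≤ σ)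
    (hp : p ≤ c * m) (hpσ : m < p - σ) : (v + δ) * (p - σ) ≤ σ + p := by
  have h1 : (v + δ) * (p - σ) ≤ (v + δ) * (p - v * m) :=
    mul_le_mul_of_nonneg_left (by linarith) (by linarith)
  have hp0 : 0 ≤ p := by nlinarith
  refine h1.trans (le_trans ?_ (add_le_add_left hσ p))
  rcases le_total (v + δ) 1 with h | h
  · nlinarith [mul_nonneg hv hm.le, mul_nonneg (add_nonneg hv hδ) (mul_nonneg hv hm.le)]
  · have h2 : 0 ≤ (v + δ - 1) * (c * m - p) := mul_nonneg (by linarith) (by linarith)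
    have h3 : 0 ≤ (v - (c - 1) / 2) ^ 2 * m := by positivity
    have h4 : 0 ≤ v * δ * m := by positivity
    have h5 : c * δ * m = (c - (c - 1) ^ 2 / 4) * m := by rw [hδc]
    nlinarith

/-- No sequence of decisions keeps the best profit proportional to the size of the last job: each
rise of the best profit worsens its ratio to the accepted size by a fixed amount. -/
theorem exists_bestProfit_lt {a c : ℝ} (ha : 0 < a) (hc : 1 ≤ c) (hcc : c ^ 2 + 1 < 6 * c)
    (hρ : ρ = c * a) (hρ1 : 1 < ρ) : ∃ n, bestProfit acc ρ (n + 1) < a * ρ ^ n := by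
  by_contra! hall
  have hρ0 : 0 < ρ := by linarith
  have hpos : ∀ n, 0 < bestProfit acc ρ (n + 1) := fun n =>
    (mul_pos ha (pow_pos hρ0 n)).trans_le (hall n)
  have hsize : ∀ n, ρ ^ (n + 1) ≤ c * bestProfit acc ρ (n + 1) := by
    intro n
    have h1 : ρ ^ (n + 1) = c * (a * ρ ^ n) := by rw [pow_succ, hρ]; ring
    rw [h1]
    exact mul_le_mul_of_nonneg_left (hall n) (by linarith)
  set δ := (c - (c - 1) ^ 2 / 4) / c with hδ
  have hδ0 : 0 < δ := div_pos (by nlinarith) (by linarith)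
  have hδc : c * δ = c - (c - 1) ^ 2 / 4 := by
    rw [hδ]
    field_simp
  have hrise : ∀ v, 0 ≤ v → ∀ n, v * bestProfit acc ρ (n + 1) ≤ acceptedSize acc ρ (n + 1) →
      bestProfit acc ρ (n + 2) ≠ bestProfit acc ρ (n + 1) →
      v < c ∧ (v + δ) * bestProfit acc ρ (n + 2) ≤ acceptedSize acc ρ (n + 2) := by
    intro v hv n h hne
    rcases bestProfit_succ_cases (acc := acc) hρ0 (n + 1) with ⟨h1, -⟩ | ⟨h1, h2, h3⟩
    · exact absurd h1 hne
    · have hm := hpos n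
      refine ⟨?_, ?_⟩
      · by_contra! hvc
        have h4 := mul_le_mul_of_nonneg_right hvc hm.le
        linarith [hsize n]
      · rw [h2, h3]
        exact ratio_rises hδ0.le hδc hm hv h (hsize n) h1
  have hstay : ∀ v, 0 ≤ v → ∀ n, v * bestProfit acc ρ (n + 1) ≤ acceptedSize acc ρ (n + 1) →
      v * bestProfit acc ρ (n + 2) ≤ acceptedSize acc ρ (n + 2) := by
    intro v hv n h
    by_cases hne : bestProfit acc ρ (n + 2) = bestProfit acc ρ (n + 1)
    · rcases bestProfit_succ_cases (acc := acc) hρ0 (n + 1) with ⟨h1, h2⟩ | ⟨h1, h2, -⟩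
      · rw [h1]
        exact h.trans h2
      · linarith
    · have h1 := (hrise v hv n h hne).2
      have h2 := mul_nonneg hδ0.le (hpos (n + 1)).le
      have h3 : v * bestProfit acc ρ (n + 2) ≤ (v + δ) * bestProfit acc ρ (n + 2) := by linarith
      exact h3.trans h1
  -- The best profit is unbounded, so it rises again after any time.
  have hnext : ∀ v, 0 ≤ v → (∃ n, v * bestProfit acc ρ (n + 1) ≤ acceptedSize acc ρ (n + 1)) →
      v < c ∧ ∃ n, (v + δ) * bestProfit acc ρ (n + 1) ≤ acceptedSize acc ρ (n + 1) := by
    rintro v hv ⟨n, hn⟩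
    have hper : ∀ k, v * bestProfit acc ρ (n + k + 1) ≤ acceptedSize acc ρ (n + k + 1) := by
      intro k
      induction k with
      | zero => exact hn
      | succ k ih => exact hstay v hv _ ih
    by_cases hconst : ∀ k, bestProfit acc ρ (n + k + 2) = bestProfit acc ρ (n + k + 1)
    · exfalso
      have hc' : ∀ k, bestProfit acc ρ (n + k + 1) = bestProfit acc ρ (n + 1) := by
        intro k
        induction k with
        | zero => rfl
        | succ k ih => exact (hconst k).trans ih
      obtain ⟨k, hk⟩ := pow_unbounded_of_one_lt (bestProfit acc ρ (n + 1) / a) hρ1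
      have h1 := hall (n + k)
      have h2 : ρ ^ k ≤ ρ ^ (n + k) := pow_le_pow_right₀ hρ1.le (by omega)
      rw [hc'] at h1
      rw [div_lt_iff₀ ha] at hk
      have h3 := mul_le_mul_of_nonneg_left h2 ha.le
      linarith
    · push Not at hconst
      obtain ⟨k, hk⟩ := hconst
      obtain ⟨h1, h2⟩ := hrise v hv (n + k) (hper k) hk
      exact ⟨h1, n + k + 1, h2⟩
  have hsize0 : 0 ≤ acceptedSize acc ρ 1 := by
    refine Finset.sum_nonneg fun k _ => ?_
    split_ifs
    exacts [(pow_pos hρ0 k).le, le_rfl]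
  have hmain : ∀ k : ℕ, ∃ n,
      (k * δ) * bestProfit acc ρ (n + 1) ≤ acceptedSize acc ρ (n + 1) := by
    intro k
    induction k with
    | zero => exact ⟨0, by simpa using hsize0⟩
    | succ k ih =>
      obtain ⟨-, n, hn⟩ := hnext (k * δ) (by positivity) ih
      refine ⟨n, ?_⟩
      push_cast
      rwa [add_mul (k : ℝ) 1 δ, one_mul]
  obtain ⟨k, hk⟩ := exists_nat_gt (c / δ)
  rw [div_lt_iff₀ hδ0] at hk
  exact hk.not_gt (hnext (k * δ) (by positivity) (hmain k)).1

end Recursion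

/-- The `n`-th job of the adversary. The sizes grow geometrically, no job has any slack, and all jobs
are released, one after the other, before time `ε`. -/
noncomputable def adversaryJob (ε ρ : ℝ) (n : ℕ) : Job :=
  ⟨ε * (1 - 1 / (n + 1)), ρ ^ n, ε * (1 - 1 / (n + 1)) + ρ ^ n⟩

section Adversary

variable {ε ρ : ℝ}

theorem adversaryJob_release_lt (hε : 0 < ε) {m n : ℕ} (h : m < n) :
    (adversaryJob ε ρ m).release < (adversaryJob ε ρ n).release := by
  have h1 : (1 : ℝ) / (n + 1) < 1 / (m + 1) := by
    apply one_div_lt_one_div_of_lt (by positivity)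
    exact_mod_cast Nat.succ_lt_succ h
  exact mul_lt_mul_of_pos_left (by linarith) hε

theorem adversaryJob_release_le (hε : 0 < ε) {m n : ℕ} (h : m ≤ n) :
    (adversaryJob ε ρ m).release ≤ (adversaryJob ε ρ n).release := by
  rcases h.lt_or_eq with h | rfl
  exacts [(adversaryJob_release_lt hε h).le, le_rfl]

theorem adversaryJob_release_nonneg (hε : 0 < ε) (n : ℕ) : 0 ≤ (adversaryJob ε ρ n).release := by
  refine (show (0 : ℝ) ≤ (adversaryJob ε ρ 0).release by simp [adversaryJob]).trans
    (adversaryJob_release_le hε (Nat.zero_le n))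

theorem adversaryJob_release_le_eps (hε : 0 < ε) (n : ℕ) : (adversaryJob ε ρ n).release ≤ ε := by
  have : (0 : ℝ) ≤ 1 / (n + 1) := by positivity
  have := mul_nonneg hε.le this
  simp only [adversaryJob]
  linarith

/-- The instance of the first `n` jobs of the adversary. -/
noncomputable def adversary (hε : 0 < ε) (hρ : 0 < ρ) (n : ℕ) : JobInstance where
  jobs := (List.range n).map (adversaryJob ε ρ)
  sorted := by
    rw [List.pairwise_map]
    exact List.pairwise_lt_range.imp fun h => (adversaryJob_release_lt hε h).le
  release_nonneg := by
    intro J hJ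
    obtain ⟨k, -, rfl⟩ := List.mem_map.1 hJ
    exact adversaryJob_release_nonneg hε k
  proc_pos := by
    intro J hJ
    obtain ⟨k, -, rfl⟩ := List.mem_map.1 hJ
    exact pow_pos hρ k
  window := by
    intro J hJ
    obtain ⟨k, -, rfl⟩ := List.mem_map.1 hJ
    exact le_rfl

theorem released_adversary (hε : 0 < ε) (hρ : 0 < ρ) {k n : ℕ} (h : k < n) :
    (adversary hε hρ n).released (adversaryJob ε ρ k).release =
      (List.range (k + 1)).map (adversaryJob ε ρ) := by
  obtain ⟨l, rfl⟩ : ∃ l, n = (k + 1) + l := ⟨n - (k + 1), by omega⟩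
  unfold JobInstance.released
  simp only [adversary]
  rw [List.range_add, List.map_append, List.filter_append, List.filter_eq_self.2,
    List.filter_eq_nil_iff.2, List.append_nil]
  · intro J hJ
    simp only [List.map_map, List.mem_map, List.mem_range, Function.comp] at hJ
    obtain ⟨i, -, rfl⟩ := hJ
    simpa using adversaryJob_release_lt hε (by omega)
  · intro J hJ
    simp only [List.mem_map, List.mem_range] at hJ
    obtain ⟨i, hi, rfl⟩ := hJ
    simpa using adversaryJob_release_le hε (by omega)

theorem profit_adversary (hε : 0 < ε) (hρ : 0 < ρ) (n : ℕ) (S : Schedule) :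
    profit (adversary hε hρ n) S =
      ∑ i ∈ Finset.range n, S.jobProfit (adversaryJob ε ρ i) i := by
  rw [DSCState.profit_eq_sum_range
    (s := ⟨(adversary hε hρ n).jobs, [], fun _ => False, fun _ => 0⟩) rfl]
  have hl : (adversary hε hρ n).jobs.length = n := by simp [adversary]
  simp only [hl]
  refine Finset.sum_congr rfl fun i hi => ?_
  have hi' := Finset.mem_range.1 hi
  congr 1
  simp [DSCState.job, adversary, List.getD, hi']

/-- Completing the last job alone. -/
theorem pow_le_optOffline_adversary (hε : 0 < ε) (hρ : 0 < ρ) (n : ℕ) :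
    ρ ^ n ≤ optOffline (adversary hε hρ (n + 1)) := by
  classical
  let S : Schedule :=
    { admits := fun i => i = n
      run := fun t => if t ∈ Set.Icc (adversaryJob ε ρ n).release (adversaryJob ε ρ n).deadline
        then some n else none
      measurable_run := fun i => by
        by_cases hi : i = n
        · subst hi
          convert (measurableSet_Icc : MeasurableSet
            (Set.Icc (adversaryJob ε ρ i).release (adversaryJob ε ρ i).deadline)) using 1
          ext t
          simp
        · convert MeasurableSet.empty using 1
          ext t
          simp [Ne.symm hi] }
  have hwork : S.work (adversaryJob ε ρ n) n = ρ ^ n := by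
    have : {t | S.run t = some n} ∩
        Set.Icc (adversaryJob ε ρ n).release (adversaryJob ε ρ n).deadline =
        Set.Icc (adversaryJob ε ρ n).release (adversaryJob ε ρ n).deadline := by
      ext t
      simp [S]
    rw [Schedule.work, this, Real.volume_Icc]
    simp [adversaryJob, (pow_pos hρ n).le]
  have hS : profit (adversary hε hρ (n + 1)) S = ρ ^ n := by
    rw [profit_adversary, Finset.sum_range_succ, Finset.sum_eq_zero, zero_add]
    · rw [Schedule.jobProfit, hwork]
      simp [S, adversaryJob, Job.value]
    · intro i hi
      have := (Finset.mem_range.1 hi).ne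
      simp [Schedule.jobProfit, S, this]
  rw [← hS]
  exact le_ciSup (bddAbove_profit _) S

/-- The windows overlap up to time `ε`, so only one job can be completed, and the jobs accepted before
it receive almost nothing. -/
theorem profit_adversary_le (hε : 0 < ε) (hε1 : ε < 1) (hρ : 1 ≤ ρ) {acc : ℕ → Prop} {n : ℕ}
    {S : Schedule} (hS : ∀ i < n, S.admits i ↔ acc i) :
    profit (adversary hε (zero_lt_one.trans_le hρ) n) S ≤ bestProfit acc ρ n + ε := by
  classical
  rw [profit_adversary]
  set K := (Finset.range n).filter
    (fun i => S.admits i ∧ ρ ^ i ≤ S.work (adversaryJob ε ρ i) i) with hK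
  have hnot : ∀ i < n, i ∉ K → S.jobProfit (adversaryJob ε ρ i) i ≤
      S.work (adversaryJob ε ρ i) i - (if acc i then ρ ^ i else 0) ∧
      S.jobProfit (adversaryJob ε ρ i) i ≤ 0 := by
    intro i hi hiK
    have hw := S.work_nonneg (adversaryJob ε ρ i) i
    have hp : (adversaryJob ε ρ i).proc = ρ ^ i := rfl
    have hiK' : S.admits i → ¬ ρ ^ i ≤ S.work (adversaryJob ε ρ i) i := fun h1 h2 =>
      hiK (Finset.mem_filter.2 ⟨Finset.mem_range.2 hi, h1, h2⟩)
    unfold Schedule.jobProfit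
    rw [hp]
    by_cases ha : S.admits i
    · have := hiK' ha
      rw [if_pos ha, if_neg this, if_pos ((hS i hi).1 ha)]
      constructor <;> linarith
    · rw [if_neg ha, if_neg fun h => ha ((hS i hi).2 h)]
      constructor <;> linarith
  by_cases hne : K.Nonempty
  · obtain ⟨hkn, hka, hkw⟩ := Finset.mem_filter.1 (K.max'_mem hne)
    set k := K.max' hne with hk
    have hkn' := Finset.mem_range.1 hkn
    have hpk : 0 ≤ ρ ^ k := by positivity
    have hwork : ∑ i ∈ Finset.range (k + 1), S.work (adversaryJob ε ρ i) i ≤ ε + ρ ^ k := by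
      refine S.sum_work_le _ (adversaryJob ε ρ) (E := Set.Icc 0 (ε + ρ ^ k)) (by linarith)
        (by rw [Real.volume_Icc, sub_zero]) ?_
      intro i hi
      have hik : i ≤ k := Nat.lt_succ_iff.1 (Finset.mem_range.1 hi)
      refine Set.Icc_subset_Icc (adversaryJob_release_nonneg hε i) ?_
      exact add_le_add (adversaryJob_release_le_eps (ρ := ρ) hε i) (pow_le_pow_right₀ hρ hik)
    rw [Finset.sum_range_succ] at hwork
    have hwork' : ∑ i ∈ Finset.range k, S.work (adversaryJob ε ρ i) i ≤ ε := by linarith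
    have hearly : ∀ i < k, i ∉ K := by
      intro i hik hiK
      have h1 := (Finset.mem_filter.1 hiK).2.2
      have h2 := Finset.single_le_sum (f := fun i => S.work (adversaryJob ε ρ i) i)
        (fun j _ => S.work_nonneg _ j) (Finset.mem_range.2 hik)
      have h3 : (1 : ℝ) ≤ ρ ^ i := one_le_pow₀ hρ
      linarith
    have hlate : ∀ i ∈ Finset.Ico (k + 1) n, S.jobProfit (adversaryJob ε ρ i) i ≤ 0 := by
      intro i hi
      obtain ⟨h1, h2⟩ := Finset.mem_Ico.1 hi
      refine (hnot i h2 fun hiK => ?_).2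
      have := K.le_max' i hiK
      omega
    rw [← Finset.sum_range_add_sum_Ico _ (show k + 1 ≤ n from hkn'), Finset.sum_range_succ]
    have h1 := Finset.sum_nonpos hlate
    have h2 : ∑ i ∈ Finset.range k, S.jobProfit (adversaryJob ε ρ i) i ≤
        ∑ i ∈ Finset.range k, S.work (adversaryJob ε ρ i) i - acceptedSize acc ρ k := by
      rw [acceptedSize, ← Finset.sum_sub_distrib]
      refine Finset.sum_le_sum fun i hi => ?_
      have hik := Finset.mem_range.1 hi
      exact (hnot i (hik.trans hkn') (hearly i hik)).1
    have h3 : S.jobProfit (adversaryJob ε ρ k) k ≤ ρ ^ k :=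
      S.jobProfit_le (pow_pos (zero_lt_one.trans_le hρ) k) k
    have h4 := le_bestProfit (ρ := ρ) ((hS k hkn').1 hka) hkn'
    linarith
  · have h1 : ∑ i ∈ Finset.range n, S.jobProfit (adversaryJob ε ρ i) i ≤ 0 := by
      refine Finset.sum_nonpos fun i hi => (hnot i (Finset.mem_range.1 hi) fun hiK => ?_).2
      exact hne ⟨i, hiK⟩
    linarith [bestProfit_nonneg (acc := acc) (ρ := ρ) n]

end Adversary

theorem optOffline_nonneg (I : JobInstance) : 0 ≤ optOffline I := by
  let S : Schedule :=
    { admits := fun _ => False, run := fun _ => none, measurable_run := fun i => by simp }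
  have hS : profit I S = 0 := by simp [profit, Schedule.jobProfit, S]
  rw [← hS]
  exact le_ciSup (bddAbove_profit I) S

theorem IsCompetitive.mono {A : JobInstance → Schedule} {α α' : ℝ} (h : IsCompetitive A α)
    (hα : α' ≤ α) : IsCompetitive A α' := fun I =>
  (mul_le_mul_of_nonneg_right hα (optOffline_nonneg I)).trans (h I)

theorem le_of_isCompetitive {A : JobInstance → Schedule} (hA : IsOnline A) {α : ℝ}
    (hα : IsCompetitive A α) : α ≤ 3 - 2 * √2 := by
  by_contra! hlt
  set τ : ℝ := 3 - 2 * √2 with hτ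
  have hsq := DSCState.sqrt_two_mul_self
  have h15 : √2 < 3 / 2 := (Real.sqrt_lt' (by norm_num)).2 (by norm_num)
  have h14 := DSCState.one_le_sqrt_two
  have hτ0 : 0 < τ := by linarith
  have hτ1 : τ ≤ 1 := by linarith
  have hττ : τ * (6 - τ) = 1 := by rw [hτ]; linear_combination (-4) * hsq
  have hτ1' : τ < 1 := by nlinarith
  wlog hα1 : α ≤ 1 generalizing α
  · exact this (hα.mono (not_le.1 hα1).le) hτ1' le_rfl
  -- A loss `ε` from staggering the releases and a growth factor `ρ` for which `ρ / (α - ε)`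
  -- remains below `1 / τ = 3 + 2√2`.
  set ε := (α - τ) / 2 with hε
  set a := (α + τ) / 2 with ha
  set ρ := (α + 3 * τ) / (4 * τ) with hρ
  have hε0 : 0 < ε := by linarith
  have ha0 : 0 < a := by linarith
  have hρ1 : 1 < ρ := by
    rw [hρ, one_lt_div (by linarith)]
    linarith
  have hc1 : 1 ≤ ρ / a := by
    rw [one_le_div ha0]
    linarith
  have hcτ : ρ / a < 6 - τ := by
    rw [div_lt_iff₀ ha0, hρ, div_lt_iff₀ (by linarith)]
    have : (6 - τ) * a * (4 * τ) = 4 * a := by linear_combination 4 * a * hττ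
    linarith
  have hcc : (ρ / a) ^ 2 + 1 < 6 * (ρ / a) := by
    have := mul_pos (show 0 < ρ / a - τ by linarith) (sub_pos.2 hcτ)
    nlinarith
  set acc : ℕ → Prop := fun k => (A (adversary hε0 (zero_lt_one.trans hρ1) (k + 1))).admits k
  obtain ⟨n, hn⟩ := exists_bestProfit_lt (acc := acc) ha0 hc1 hcc
    (div_mul_cancel₀ ρ ha0.ne').symm hρ1
  have hS : ∀ i < n + 1, (A (adversary hε0 (zero_lt_one.trans hρ1) (n + 1))).admits i ↔ acc i := by
    intro i hi
    have h1 := released_adversary hε0 (zero_lt_one.trans hρ1) hi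
    have h2 := released_adversary hε0 (zero_lt_one.trans hρ1) (Nat.lt_succ_self i)
    exact (hA _ _ _ (h1.trans h2.symm)).1 i (by rw [h1]; simp)
  have h1 := profit_adversary_le hε0 (by linarith) hρ1.le hS
  have h2 := hα (adversary hε0 (zero_lt_one.trans hρ1) (n + 1))
  have h3 := mul_le_mul_of_nonneg_left
    (pow_le_optOffline_adversary hε0 (zero_lt_one.trans hρ1) n) (show 0 ≤ α by linarith)
  have h4 : (1 : ℝ) ≤ ρ ^ n := one_le_pow₀ hρ1.le
  have h5 := mul_le_mul_of_nonneg_left h4 hε0.le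
  have h6 : α * ρ ^ n = a * ρ ^ n + ε * ρ ^ n := by rw [ha, hε]; ring
  linarith

end DeadlineScheduling

theorem theorem1 :
    (IsOnline (dsc (1 + √2)) ∧ IsCompetitive (dsc (1 + √2)) (3 - 2 * √2)) ∧
      ∀ A : JobInstance → Schedule, IsOnline A →
        ∀ α : ℝ, IsCompetitive A α → α ≤ 3 - 2 * √2 :=
  ⟨⟨isOnline_dsc, isCompetitive_dsc⟩, fun _ hA _ hα => le_of_isCompetitive hA hα⟩
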